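/- Let $e_1,\dots,e_n$ be the standard basis of $\mathbb{C}^n$, and for an $n\times n$ matrix $r$ write $r_{ij}=\langle e_i, r e_j\rangle$. For $1\le k\le n$ let $\nu^{(k)}$ be the law on the unitary group $U(n)$ of the random reflection $$r=\mathrm{Id}-\frac{(v-e_k)(v-e_k)^*}{1-\overline{v_k}},$$ where $v$ is uniformly distributed on the unit sphere of $\{x\in\mathbb{C}^n : x_j=0 \text{ for } j<k\}$; thus $r-\mathrm{Id}$ has rank at most $1$, $re_j=e_j$ for $j<k$, and $re_k=v$. For $\delta\in\mathbb{C}$ with $\Re\delta>-\tfrac12$ let $\nu^{(k)}_\delta$ be the probability measure on $U(n)$ with $$\mathbb{E}_{\nu^{(k)}_\delta}(f(r))=\frac{\mathbb{E}_{\nu^{(k)}}\big(f(r)\,(1-r_{kk})^{\overline\delta}(1-\overline{r_{kk}})^{\delta}\big)}{\mathbb{E}_{\nu^{(k)}}\big((1-r_{kk})^{\overline\delta}(1-\overline{r_{kk}})^{\delta}\big)}$$ for all bounded measurable $f$; for $\delta=1$ the weight is $|1-r_{kk}|^2$. For random unitary matrices $u,v$ write $u\stackrel{\mathrm{SP}}{=}v$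 if their spectra (the eigenvalues counted with multiplicity) are equally distributed. **Slipping lemma.** Let $r^{(k)}\sim\nu^{(k)}$ ($1\le k\le n-1$) and $r_1^{(k)}\sim\nu_1^{(k)}$ ($2\le k\le n$) be independent. Then $$r^{(1)}\cdots r^{(n-1)}\stackrel{\mathrm{SP}}{=}r_1^{(2)}\cdots r_1^{(n)}.$$ **General version.** Let $m\le n-1$, let $\delta_1,\dots,\delta_m\in\mathbb{C}$ have real parts greater than $-\tfrac12$, and let $r^{(k)}_{\delta_k}\sim\nu^{(k)}_{\delta_k}$ ($1\le k\le m$) and $r^{(k)}_{\delta_{k-1}+1}\sim\nu^{(k)}_{\delta_{k-1}+1}$ ($2\le k\le m+1$) be independent. Then $$r^{(1)}_{\delta_1}\cdots r^{(m)}_{\delta_m}\stackrel{\mathrm{SP}}{=}r^{(2)}_{\delta_1+1}\cdots r^{(m+1)}_{\delta_m+1}.$$ **Iterated version.** Let $0\le p\le n$, and let $r^{(k)}\sim\nu^{(k)}$ ($1\le k\le n-p$) and $r_p^{(k)}\sim\nu_p^{(k)}$ ($p+1\le k\le n$) be independent. Then $$r^{(1)}\cdots r^{(n-p)}\stackrel{\mathrm{SP}}{=}r_p^{(p+1)}\cdots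 r_p^{(n)}.$$ In each of the three statements it is enough that each of the two families is independent. -/

import Mathlib

open MeasureTheory ProbabilityTheory

/-- The entrywise (product) σ-algebra on matrices. On complex matrices it is the Borel σ-algebra,
and the unitary group `Matrix.unitaryGroup (Fin n) ℂ` carries the induced one. -/
instance Matrix.instMeasurableSpacePi {m n α : Type*} [MeasurableSpace α] :
    MeasurableSpace (Matrix m n α) :=
  inferInstanceAs (MeasurableSpace (m → n → α))

/-! Coordinates are indexed by `Fin n`, hence counted from `0`: the element `k : Fin n` stands for
the coordinate with number `k + 1`. -/

/-- The Euclidean space of the coordinates `j ≥ k`. -/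
abbrev TailSpace {n : ℕ} (k : Fin n) : Type := EuclideanSpace ℂ {j : Fin n // k ≤ j}

/-- The uniform probability measure on the complex unit sphere of the coordinates `j ≥ k`, that is,
the normalized surface measure. -/
noncomputable def uniformSphere {n : ℕ} (k : Fin n) :
    Measure (Metric.sphere (0 : TailSpace k) 1) :=
  ((volume : Measure (TailSpace k)).toSphere Set.univ)⁻¹ • (volume : Measure (TailSpace k)).toSphere

/-- Extension of a vector of the coordinates `j ≥ k` to a vector of `ℂⁿ` by zeros. -/
noncomputable def extendZero {n : ℕ} (k : Fin n) (x : TailSpace k) : Fin n → ℂ :=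
  fun j => if h : k ≤ j then x ⟨j, h⟩ else 0

/-- The reflection that maps `e_k` to the unit vector `v`. With `w = v - e_k` its entries are
`1_{i = j} - w_i * conj (w_j) / (1 - conj (v_k))`: its column `k` is `v`, and its column `j ≠ k` is
`e_j - w * conj (v_j) / (1 - conj (v_k))`. (If `v = e_k`, then it is the identity matrix.) -/
noncomputable def reflectionMatrix {n : ℕ} (k : Fin n) (v : Fin n → ℂ) :
    Matrix (Fin n) (Fin n) ℂ :=
  1 - (1 - star (v k))⁻¹ •
    Matrix.vecMulVec (v - Pi.single k 1) (star (v - Pi.single k 1))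

theorem extendZero_dotProduct {n : ℕ} (k : Fin n) (x : Metric.sphere (0 : TailSpace k) 1) :
    star (extendZero k x) ⬝ᵥ extendZero k x = 1 := by
  have hx : ‖(x : TailSpace k)‖ = 1 := by simp
  rw [EuclideanSpace.norm_eq, Real.sqrt_eq_one] at hx
  have h1 : ∀ j, star (extendZero k x) j * extendZero k x j
      = if h : k ≤ j then ((‖(x : TailSpace k) ⟨j, h⟩‖ ^ 2 : ℝ) : ℂ) else 0 := by
    intro j
    by_cases h : k ≤ j
    · simp [extendZero, h, Complex.conj_mul']
    · simp [extendZero, h]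
  have h2 : star (extendZero k x) ⬝ᵥ extendZero k x
      = ((∑ j : {j : Fin n // k ≤ j}, ‖(x : TailSpace k) j‖ ^ 2 : ℝ) : ℂ) := by
    rw [dotProduct, Finset.sum_congr rfl fun j _ => h1 j, Finset.sum_dite]
    simp only [Finset.sum_const_zero, add_zero]
    push_cast
    refine Finset.sum_bij' (fun j _ => ⟨j.1, (Finset.mem_filter.1 j.2).2⟩)
      (fun j _ => ⟨j.1, by simpa using j.2⟩) ?_ ?_ ?_ ?_ ?_ <;> simp
  rw [h2, hx]; simp

theorem reflectionMatrix_mem {n : ℕ} (k : Fin n) (v : Fin n → ℂ) (hv : star v ⬝ᵥ v = 1) :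
    reflectionMatrix k v ∈ Matrix.unitaryGroup (Fin n) ℂ := by
  rw [Matrix.mem_unitaryGroup_iff]
  unfold reflectionMatrix
  by_cases h : 1 - v k = 0
  · have h' : 1 - star (v k) = 0 := by rw [← star_one ℂ, ← star_sub, h, star_zero]
    rw [h', inv_zero, zero_smul, sub_zero, star_one, one_mul]
  have h' : 1 - star (v k) ≠ 0 := by
    rw [← star_one ℂ, ← star_sub]; exact star_ne_zero.mpr h
  have hw : star (v - Pi.single k 1) ⬝ᵥ (v - Pi.single k 1)
      = (1 - v k) + (1 - star (v k)) := by
    have e : star (Pi.single k 1 : Fin n → ℂ) = Pi.single k 1 := by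
      ext j; by_cases hj : j = k
      · subst hj; simp
      · simp [hj]
    rw [star_sub, e, sub_dotProduct, dotProduct_sub, dotProduct_sub, hv]
    simp
    ring
  generalize v - Pi.single k 1 = w at hw
  have hs : star (Matrix.vecMulVec w (star w)) = Matrix.vecMulVec w (star w) := by
    rw [Matrix.star_eq_conjTranspose, Matrix.conjTranspose_vecMulVec, star_star]
  rw [star_sub, star_one, star_smul, hs, star_inv₀, star_sub, star_one, star_star, sub_mul, mul_sub,
    mul_sub, one_mul, mul_one, one_mul, smul_mul_smul_comm, Matrix.vecMulVec_mul_vecMulVec, hw,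
    Matrix.vecMulVec_smul, smul_smul]
  have : (1 - star (v k))⁻¹ * (1 - v k)⁻¹ * (1 - v k + (1 - star (v k)))
      = (1 - star (v k))⁻¹ + (1 - v k)⁻¹ := by field_simp
  rw [this, add_smul]
  abel

/-- The reflection in `U(n)` that fixes `e_j` for `j < k` and maps `e_k` to the unit vector `x` of
the coordinates `j ≥ k`. -/
noncomputable def reflection {n : ℕ} (k : Fin n) (x : Metric.sphere (0 : TailSpace k) 1) :
    Matrix.unitaryGroup (Fin n) ℂ :=
  ⟨reflectionMatrix k (extendZero k x), reflectionMatrix_mem k _ (extendZero_dotProduct k x)⟩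

/-- So the push-forward in the next definition is a genuine one. -/
theorem measurable_reflection {n : ℕ} (k : Fin n) : Measurable (reflection k) := by
  have hE : ∀ j, Measurable fun x : Metric.sphere (0 : TailSpace k) 1 => extendZero k x j := by
    intro j
    unfold extendZero
    by_cases h : k ≤ j
    · simp only [h, dite_true]; fun_prop
    · simp [h]
  refine Measurable.subtype_mk (measurable_pi_iff.2 fun i => measurable_pi_iff.2 fun j => ?_)
  simp only [reflectionMatrix, Matrix.sub_apply, Matrix.smul_apply, Matrix.vecMulVec_apply,
    Pi.sub_apply, Pi.star_apply, smul_eq_mul]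
  have h1 := hE i
  have h2 := hE j
  have h3 := hE k
  have hst : Measurable (star : ℂ → ℂ) := Complex.continuous_conj.measurable
  exact measurable_const.sub (((measurable_const.sub (hst.comp h3)).inv).mul
    ((h1.sub measurable_const).mul (hst.comp (h2.sub measurable_const))))

/-- The law `ν^{(k)}` on `U(n)` of a reflection that fixes `e_j` for `j < k` and maps `e_k` to a
uniformly distributed unit vector of the coordinates `j ≥ k`. -/
noncomputable def nu {n : ℕ} (k : Fin n) : Measure (Matrix.unitaryGroup (Fin n) ℂ) :=
  (uniformSphere k).map (reflection k)

/-- The `h`-sampling of `μ`, that is, the measure `h dμ / ∫ h dμ`, for `h ≥ 0` with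
`0 < ∫ h dμ < ∞`. -/
noncomputable def sampling {X : Type*} [MeasurableSpace X] (μ : Measure X) (h : X → ℝ) :
    Measure X :=
  (∫⁻ x, ENNReal.ofReal (h x) ∂μ)⁻¹ • μ.withDensity fun x => ENNReal.ofReal (h x)

/-- The weight `(1 - r_kk)^{conj δ} * (1 - conj r_kk)^δ` (principal powers). The product is a
nonnegative real number, see the next theorem, so taking its real part only changes its type. -/
noncomputable def expWeight {n : ℕ} (k : Fin n) (δ : ℂ) (r : Matrix.unitaryGroup (Fin n) ℂ) : ℝ :=
  ((1 - (r : Matrix (Fin n) (Fin n) ℂ) k k) ^ (star δ) *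
    (1 - star ((r : Matrix (Fin n) (Fin n) ℂ) k k)) ^ δ).re

theorem expWeight_eq {n : ℕ} (k : Fin n) (δ : ℂ) (r : Matrix.unitaryGroup (Fin n) ℂ) :
    (1 - (r : Matrix (Fin n) (Fin n) ℂ) k k) ^ (star δ) *
      (1 - star ((r : Matrix (Fin n) (Fin n) ℂ) k k)) ^ δ = (expWeight k δ r : ℂ) ∧
    0 ≤ expWeight k δ r := by
  have h1 : ‖(r : Matrix (Fin n) (Fin n) ℂ) k k‖ ≤ 1 := entry_norm_bound_of_unitary r.2 k k
  set z : ℂ := 1 - (r : Matrix (Fin n) (Fin n) ℂ) k k with hz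
  have hre : 0 ≤ z.re := by
    have := (Complex.re_le_norm ((r : Matrix (Fin n) (Fin n) ℂ) k k)).trans h1
    simp [hz]; linarith
  have harg : z.arg ≠ Real.pi := by
    rw [Ne, Complex.arg_eq_pi_iff]; intro h; linarith [h.1]
  have hzs : 1 - star ((r : Matrix (Fin n) (Fin n) ℂ) k k) = star z := by simp [hz]
  have key : z ^ (star δ) * (star z) ^ δ = ((‖z ^ star δ‖ ^ 2 : ℝ) : ℂ) := by
    have := Complex.conj_cpow z δ harg
    simp only [← Complex.star_def] at this
    rw [this, Complex.star_def, Complex.mul_conj']; simp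
  have hw : expWeight k δ r = ‖z ^ star δ‖ ^ 2 := by
    rw [expWeight, ← hz, hzs, key, Complex.ofReal_re]
  rw [hzs, key, hw]
  exact ⟨rfl, by positivity⟩

/-- The law `ν_δ^{(k)}`: the sampling of `ν^{(k)}` by the weight
`(1 - r_kk)^{conj δ} * (1 - conj r_kk)^δ`, which is `|1 - r_kk| ^ 2` for `δ = 1`. -/
noncomputable def nuDelta {n : ℕ} (k : Fin n) (δ : ℂ) :
    Measure (Matrix.unitaryGroup (Fin n) ℂ) :=
  sampling (nu k) (expWeight k δ)

/-- The spectrum of `u`, with multiplicities, as a point configuration in `ℂ`: the sum of the unit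
point masses at the eigenvalues. As a random variable it takes its values in the space `Measure ℂ`,
whose σ-algebra is generated by the maps `m ↦ m B`, `B` Borel: here, by the numbers of
eigenvalues in Borel sets. -/
noncomputable def spectralCount {n : ℕ} (u : Matrix.unitaryGroup (Fin n) ℂ) : Measure ℂ :=
  ((u : Matrix (Fin n) (Fin n) ℂ).charpoly.roots.map fun z => Measure.dirac z).sum

/-- The ordered product `r_0 * r_1 * ⋯ * r_{m-1}` of a finite family of random unitary matrices. -/
noncomputable def orderedProd {Ω : Type*} {n m : ℕ} (r : Fin m → Ω → Matrix.unitaryGroup (Fin n) ℂ)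
    (ω : Ω) : Matrix.unitaryGroup (Fin n) ℂ :=
  (List.ofFn fun i => r i ω).prod

/-- The spectra of two random unitary matrices, defined on the probability spaces `(Ω, P)` and
`(Ω', P')`, are equally distributed. -/
def SpectraEquallyDistributed {Ω Ω' : Type*} [MeasurableSpace Ω] [MeasurableSpace Ω'] {n : ℕ}
    (u : Ω → Matrix.unitaryGroup (Fin n) ℂ) (v : Ω' → Matrix.unitaryGroup (Fin n) ℂ)
    (P : Measure Ω) (P' : Measure Ω') : Prop :=
  IdentDistrib (fun ω => spectralCount (u ω)) (fun ω => spectralCount (v ω)) P P'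

/-! With indices counted from 0, a reflection with index `k` sending `e_k` to `v` has the form `1 -
ω p p*`, where `ω` is the phase of `1 - v_k`, `ρ = |1 - v_k|`, and `p = √ρ (-ω, η)` with `η` the
later coordinates of `v` divided by `ρ`. Up to a null set the sphere is parametrized by `η` and the
real number `β` with `ω = (1 - iβ)/√(1 + β²)`, and in these parameters its surface measure has an
explicit density.

One slip: let `B` fix `e_0, …, e_{k+1}`. If `p` and `q` have equal norm and differ only in
coordinates `k` and `k + 1`, the complex reflection `g` along `p - q` takes `p` to `q` and commutes
with `B`, so `(1 - ω q q*) B = g (1 - ω p p*) B g⁻¹`. A point of the sphere of index `k` with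
parameters `β`, `η = (z, √(1 + |z|²) y)` is paired in this way with the point of index `k + 1` with
parameters `β`, `y`. In the variables `z`, `y` the weighted density of exponent `δ` at index `k` is
a function of `z` times the weighted density of exponent `δ + 1` at index `k + 1`: lowering the
dimension of the sphere leaves over a factor `ρ²` of the second point, which is the extra weight `|1
- v_{k+1}|²`. Integrating out `z` gives `weightedSphereIntegral_slip`, and after normalization
`nuDelta_preimage_mul_right_eq`.

Products are handled by induction on their length, with the stronger claim that the two laws agree
on every measurable set invariant under conjugation by `headFixing n k`, where `k` is the first
index (`orderedLaw_slip`). The tail of the product is slipped first. This is allowed because the law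
of the first factor is invariant under conjugation by `headFixing n (k + 1)`
(`nuDelta_preimage_conj`), so that averaging over the first factor leaves a class function of the
tail for that subgroup. The slipped tail fixes `e_0, …, e_{k+1}`, hence can play the role of `B` for
the first factor. Spectral events are invariant under all conjugations, and the iterated version
repeats the slip with exponents `0, 1, …, p - 1`. -/

/-! ### Measurability of matrix operations. -/

section MatrixMeasurability

theorem measurable_matrix_entry {m n α : Type*} [MeasurableSpace α] (i : m) (j : n) :
    Measurable fun A : Matrix m n α => A i j :=
  (measurable_pi_apply j).comp (measurable_pi_apply i)

theorem measurable_unitary_entry {n : ℕ} (i j : Fin n) :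
    Measurable fun u : Matrix.unitaryGroup (Fin n) ℂ => (u : Matrix (Fin n) (Fin n) ℂ) i j :=
  (measurable_matrix_entry i j).comp measurable_subtype_coe

theorem measurable_unitary_mk {X : Type*} [MeasurableSpace X] {n : ℕ}
    {f : X → Matrix.unitaryGroup (Fin n) ℂ}
    (hf : ∀ i j, Measurable fun x => (f x : Matrix (Fin n) (Fin n) ℂ) i j) : Measurable f :=
  Measurable.subtype_mk (h := fun x => (f x).2)
    (measurable_pi_iff.2 fun i => measurable_pi_iff.2 fun j => hf i j)

instance unitaryGroup.instMeasurableMul₂ {n : ℕ} :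
    MeasurableMul₂ (Matrix.unitaryGroup (Fin n) ℂ) where
  measurable_mul := by
    refine measurable_unitary_mk fun i j => ?_
    simp only [Submonoid.coe_mul, Matrix.mul_apply]
    exact Finset.measurable_sum _ fun l _ =>
      ((measurable_unitary_entry i l).comp measurable_fst).mul
        ((measurable_unitary_entry l j).comp measurable_snd)

end MatrixMeasurability

/-! ### Measurability and conjugation invariance of the spectrum. -/

section Spectrum

/-- A family of polynomials all of whose coefficients are measurable. -/
def MeasurableCoeffs {X R : Type*} [MeasurableSpace X] [Semiring R] [MeasurableSpace R]
    (p : X → Polynomial R) : Prop :=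
  ∀ k, Measurable fun x => (p x).coeff k

namespace MeasurableCoeffs

variable {X : Type*} [MeasurableSpace X] {p q : X → Polynomial ℂ}

theorem const (a : Polynomial ℂ) : MeasurableCoeffs fun _ : X => a := fun _ => measurable_const

theorem C {f : X → ℂ} (hf : Measurable f) : MeasurableCoeffs fun x => Polynomial.C (f x) := by
  intro k
  simp only [Polynomial.coeff_C]
  split_ifs
  · exact hf
  · exact measurable_const

theorem sub (hp : MeasurableCoeffs p) (hq : MeasurableCoeffs q) :
    MeasurableCoeffs fun x => p x - q x := by
  intro k
  simp only [Polynomial.coeff_sub]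
  exact (hp k).sub (hq k)

theorem mul (hp : MeasurableCoeffs p) (hq : MeasurableCoeffs q) :
    MeasurableCoeffs fun x => p x * q x := by
  intro k
  simp only [Polynomial.coeff_mul]
  exact Finset.measurable_sum _ fun i _ => (hp _).mul (hq _)

theorem sum {ι : Type*} (s : Finset ι) {p : ι → X → Polynomial ℂ}
    (hp : ∀ i, MeasurableCoeffs (p i)) : MeasurableCoeffs fun x => ∑ i ∈ s, p i x := by
  intro k
  simp only [Polynomial.finsetSum_coeff]
  exact Finset.measurable_sum _ fun i _ => hp i k

theorem prod {ι : Type*} (s : Finset ι) {p : ι → X → Polynomial ℂ}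
    (hp : ∀ i, MeasurableCoeffs (p i)) : MeasurableCoeffs fun x => ∏ i ∈ s, p i x := by
  classical
  induction s using Finset.induction_on with
  | empty => simpa using const 1
  | insert a s ha ih => simp only [Finset.prod_insert ha]; exact (hp a).mul ih

end MeasurableCoeffs

theorem measurableCoeffs_charpoly {n : ℕ} :
    MeasurableCoeffs fun u : Matrix.unitaryGroup (Fin n) ℂ =>
      (u : Matrix (Fin n) (Fin n) ℂ).charpoly := by
  simp only [Matrix.charpoly, Matrix.det_apply', Matrix.charmatrix_apply]
  exact MeasurableCoeffs.sum _ fun σ => (MeasurableCoeffs.const _).mul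
    (MeasurableCoeffs.prod _ fun i => (MeasurableCoeffs.const _).sub
      (MeasurableCoeffs.C (measurable_unitary_entry _ _)))

theorem measurableCoeffs_prod_X_sub_C {n : ℕ} :
    MeasurableCoeffs fun z : Fin n → ℂ => ∏ i, (Polynomial.X - Polynomial.C (z i)) :=
  MeasurableCoeffs.prod _ fun i => (MeasurableCoeffs.const _).sub
    (MeasurableCoeffs.C (measurable_pi_apply i))

/-- The sum of the unit masses at the roots of a polynomial, counted with multiplicity. -/
noncomputable def rootCount (p : Polynomial ℂ) : Measure ℂ :=
  (p.roots.map fun z => Measure.dirac z).sum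

/-- The polynomial with the leading term `X ^ n` and the given lower coefficients. -/
noncomputable def monicOfCoeffs {n : ℕ} (c : Fin n → ℂ) : Polynomial ℂ :=
  Polynomial.X ^ n + ∑ i : Fin n, Polynomial.C (c i) * Polynomial.X ^ (i : ℕ)

theorem monicOfCoeffs_coeff {n : ℕ} {p : Polynomial ℂ} (hp : p.Monic) (hn : p.natDegree = n) :
    monicOfCoeffs (fun i : Fin n => p.coeff i) = p := by
  conv_rhs => rw [hp.as_sum, hn]
  rw [monicOfCoeffs, Finset.sum_range fun i => Polynomial.C (p.coeff i) * Polynomial.X ^ i]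

theorem exists_roots_monicOfCoeffs {n : ℕ} (c : Fin n → ℂ) :
    ∃ z : Fin n → ℂ, (fun i : Fin n => (∏ j, (Polynomial.X - Polynomial.C (z j))).coeff i) = c := by
  have hdeg : (∑ i : Fin n, Polynomial.C (c i) * Polynomial.X ^ (i : ℕ)).degree
      < (n : WithBot ℕ) := Polynomial.degree_sum_fin_lt c
  have hm : (monicOfCoeffs c).Monic := Polynomial.monic_X_pow_add hdeg
  have hd : (monicOfCoeffs c).natDegree = n := by
    refine Polynomial.natDegree_eq_of_degree_eq_some ?_
    rw [monicOfCoeffs, Polynomial.degree_add_eq_left_of_degree_lt (by simpa using hdeg)]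
    simp
  have hs : (monicOfCoeffs c).Splits := IsAlgClosed.splits _
  have hc : (monicOfCoeffs c).roots.toList.length = n := by
    rw [Multiset.length_toList, ← hs.natDegree_eq_card_roots, hd]
  refine ⟨fun i => (monicOfCoeffs c).roots.toList.get (i.cast hc.symm), ?_⟩
  have hprod : ∏ j : Fin n, (Polynomial.X - Polynomial.C
      ((monicOfCoeffs c).roots.toList.get (j.cast hc.symm))) = monicOfCoeffs c := by
    rw [← Fintype.prod_equiv (finCongr hc) (fun j => Polynomial.X - Polynomial.C
      ((monicOfCoeffs c).roots.toList.get j)) _ (fun j => by simp)]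
    rw [hs.eq_prod_roots_of_monic hm]
    conv_rhs => rw [← Multiset.coe_toList (monicOfCoeffs c).roots]
    rw [Multiset.map_coe, Multiset.prod_coe, ← List.prod_ofFn, ← hs.eq_prod_roots_of_monic hm]
    congr 1
    rw [← Function.comp_def (fun a => Polynomial.X - Polynomial.C a), ← List.map_ofFn,
      List.ofFn_get]
  funext i
  rw [hprod, monicOfCoeffs]
  simp only [Polynomial.coeff_add, Polynomial.coeff_X_pow, Polynomial.finsetSum_coeff,
    Polynomial.coeff_C_mul]
  simp [i.2.ne, Fin.val_inj]

theorem measurable_finset_sum_measure {X Y ι : Type*} [MeasurableSpace X] [MeasurableSpace Y]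
    (s : Finset ι) {μ : ι → X → Measure Y} (h : ∀ i, Measurable (μ i)) :
    Measurable fun x => ∑ i ∈ s, μ i x := by
  refine Measure.measurable_of_measurable_coe _ fun B hB => ?_
  simp only [Measure.coe_finsetSum, Finset.sum_apply]
  exact Finset.measurable_sum _ fun i _ => (Measure.measurable_coe hB).comp (h i)

/-- No measurable choice or continuity of roots is needed: the map from root tuples to coefficients
is a measurable surjection of standard Borel spaces, so measurability may be tested after composing
with it. The composite is a sum of Dirac masses at the coordinates. -/
theorem measurable_rootCount_monicOfCoeffs {n : ℕ} :
    Measurable fun c : Fin n → ℂ => rootCount (monicOfCoeffs c) := by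
  have hf : Measurable fun z : Fin n → ℂ => fun i : Fin n =>
      (∏ j, (Polynomial.X - Polynomial.C (z j))).coeff i :=
    measurable_pi_iff.2 fun i => measurableCoeffs_prod_X_sub_C i
  rw [← hf.measurable_comp_iff_of_surjective exists_roots_monicOfCoeffs]
  have : ((fun c : Fin n → ℂ => rootCount (monicOfCoeffs c)) ∘ fun z : Fin n → ℂ =>
      fun i : Fin n => (∏ j, (Polynomial.X - Polynomial.C (z j))).coeff i)
      = fun z => ∑ i, Measure.dirac (z i) := by
    funext z
    have hm : (∏ j, (Polynomial.X - Polynomial.C (z j))).Monic :=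
      Polynomial.monic_prod_of_monic _ _ fun j _ => Polynomial.monic_X_sub_C _
    rw [Function.comp_apply, monicOfCoeffs_coeff hm (by
      rw [Polynomial.natDegree_prod_of_monic _ _ fun j _ => Polynomial.monic_X_sub_C _]; simp),
      rootCount, Polynomial.roots_prod _ _ hm.ne_zero]
    simp [Finset.sum, Function.comp_def]
  rw [this]
  exact measurable_finset_sum_measure _ fun i =>
    Measure.measurable_dirac.comp (measurable_pi_apply i)

theorem measurable_spectralCount {n : ℕ} :
    Measurable (spectralCount : Matrix.unitaryGroup (Fin n) ℂ → Measure ℂ) := by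
  have h : (spectralCount : Matrix.unitaryGroup (Fin n) ℂ → Measure ℂ)
      = fun u : Matrix.unitaryGroup (Fin n) ℂ => rootCount (monicOfCoeffs fun i : Fin n =>
          (u : Matrix (Fin n) (Fin n) ℂ).charpoly.coeff i) := by
    funext u
    rw [monicOfCoeffs_coeff (Matrix.charpoly_monic _) (by simp [Matrix.charpoly_natDegree_eq_dim])]
    rfl
  rw [h]
  exact measurable_rootCount_monicOfCoeffs.comp
    (measurable_pi_iff.2 fun i => measurableCoeffs_charpoly i)

theorem spectralCount_conj {n : ℕ} (g u : Matrix.unitaryGroup (Fin n) ℂ) :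
    spectralCount (g * u * g⁻¹) = spectralCount u := by
  have h : ((g * u * g⁻¹ : Matrix.unitaryGroup (Fin n) ℂ) : Matrix (Fin n) (Fin n) ℂ).charpoly
      = (u : Matrix (Fin n) (Fin n) ℂ).charpoly := by
    rw [Submonoid.coe_mul, Matrix.charpoly_mul_comm, ← Submonoid.coe_mul]
    simp only [inv_mul_cancel_left]
  rw [spectralCount, spectralCount, h]

end Spectrum

/-! ### Changes of variables in Lebesgue integrals. -/

section ChangeOfVariables

open Set Module
open scoped ENNReal

theorem lintegral_eq_lintegral_comp_smul {E : Type*} [NormedAddCommGroup E] [NormedSpace ℝ E]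
    [MeasurableSpace E] [BorelSpace E] [FiniteDimensional ℝ E] (μ : Measure E)
    [μ.IsAddHaarMeasure] {f : E → ℝ≥0∞} (hf : Measurable f) {r : ℝ} (hr : 0 < r) :
    ∫⁻ x, f x ∂μ = ENNReal.ofReal (r ^ finrank ℝ E) * ∫⁻ x, f (r • x) ∂μ := by
  rw [← lintegral_map hf (measurable_const_smul r), Measure.map_addHaar_smul μ hr.ne',
    lintegral_smul_measure, smul_eq_mul, ← mul_assoc, ← ENNReal.ofReal_mul (by positivity),
    abs_of_pos (by positivity), mul_inv_cancel₀ (by positivity), ENNReal.ofReal_one, one_mul]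

theorem lintegral_pi_eq_lintegral_comp_smul {κ : Type*} [Fintype κ] {f : (κ → ℂ) → ℝ≥0∞}
    (hf : Measurable f) {r : ℝ} (hr : 0 < r) :
    ∫⁻ x, f x = ENNReal.ofReal (r ^ (2 * Fintype.card κ)) * ∫⁻ x, f (r • x) := by
  rw [lintegral_eq_lintegral_comp_smul volume hf hr]
  simp [finrank_pi_fintype, mul_comm]

/-- Polar coordinates: a function constant on rays splits off the radial integral over `(0, 1)`,
whose inverse is `C`. The value of `C` is irrelevant later, only its independence of `G`. -/
theorem lintegral_toSphere {E : Type*} [NormedAddCommGroup E] [NormedSpace ℝ E]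
    [MeasurableSpace E] [BorelSpace E] [FiniteDimensional ℝ E] [Nontrivial E] (μ : Measure E)
    [μ.IsAddHaarMeasure] :
    ∃ C : ℝ≥0∞, ∀ G : E → ℝ≥0∞, Measurable G → ∫⁻ v, G v ∂μ.toSphere
      = C * ∫⁻ x, (Metric.ball 0 1).indicator (fun x => G (‖x‖⁻¹ • x)) x ∂μ := by
  set D := finrank ℝ E
  refine ⟨(Measure.volumeIoiPow (D - 1) (Iio ⟨1, mem_Ioi.2 one_pos⟩))⁻¹, fun G hG => ?_⟩
  set f : E → ℝ≥0∞ := (Metric.ball 0 1).indicator (fun x => G (‖x‖⁻¹ • x)) with hf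
  have hfm : Measurable f := by
    refine Measurable.indicator ?_ Metric.isOpen_ball.measurableSet
    exact hG.comp (by fun_prop)
  have h1 : ∫⁻ x, f x ∂μ = ∫⁻ x : ({0}ᶜ : Set E), f x ∂(μ.comap (↑)) := by
    rw [lintegral_subtype_comap (measurableSet_singleton _).compl, restrict_compl_singleton]
  have h2 : ∫⁻ x : ({0}ᶜ : Set E), f x ∂(μ.comap (↑))
      = ∫⁻ p : Metric.sphere (0 : E) 1 × Ioi (0 : ℝ), f (p.2.1 • p.1.1)
        ∂(μ.toSphere.prod (Measure.volumeIoiPow (D - 1))) := by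
    rw [← (μ.measurePreserving_homeomorphUnitSphereProd).lintegral_comp_emb
      (homeomorphUnitSphereProd E).measurableEmbedding]
    refine lintegral_congr fun x => ?_
    congr 1
    exact (congrArg Subtype.val ((homeomorphUnitSphereProd E).symm_apply_apply x)).symm
  have h3 : ∀ p : Metric.sphere (0 : E) 1 × Ioi (0 : ℝ), f (p.2.1 • p.1.1)
      = G p.1 * (Iio (⟨1, mem_Ioi.2 one_pos⟩ : Ioi (0 : ℝ))).indicator 1 p.2 := by
    rintro ⟨⟨v, hv⟩, ⟨r, hr⟩⟩
    have hv : ‖v‖ = 1 := by simpa using hv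
    have hr : 0 < r := hr
    have hn : ‖r • v‖ = r := by rw [norm_smul, hv, mul_one, Real.norm_of_nonneg hr.le]
    by_cases h : r < 1
    · have h' : (⟨r, hr⟩ : Ioi (0 : ℝ)) ∈ Iio (⟨1, mem_Ioi.2 one_pos⟩ : Ioi (0 : ℝ)) := h
      rw [indicator_of_mem h', hf, indicator_of_mem (by simpa [hn] using h), hn, smul_smul,
        inv_mul_cancel₀ hr.ne', one_smul]
      simp
    · have h' : (⟨r, hr⟩ : Ioi (0 : ℝ)) ∉ Iio (⟨1, mem_Ioi.2 one_pos⟩ : Ioi (0 : ℝ)) := h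
      rw [indicator_of_notMem h', hf, indicator_of_notMem (by simpa [hn] using h), mul_zero]
  rw [h1, h2, lintegral_congr h3, lintegral_prod_mul (f := fun v : Metric.sphere (0 : E) 1 => G v)
    (g := (Iio (⟨1, mem_Ioi.2 one_pos⟩ : Ioi (0 : ℝ))).indicator 1)
    (hG.comp measurable_subtype_coe).aemeasurable
    ((measurable_one.indicator measurableSet_Iio).aemeasurable),
    lintegral_indicator_one measurableSet_Iio, mul_comm, mul_assoc, ENNReal.mul_inv_cancel, mul_one]
  · rw [Measure.volumeIoiPow_apply_Iio]; simp; positivity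
  · rw [Measure.volumeIoiPow_apply_Iio]; exact ENNReal.ofReal_ne_top

theorem measurePreserving_optionElim {κ ι : Type*} [Fintype κ] [Fintype ι] (e : Option κ ≃ ι) :
    MeasurePreserving fun (p : (κ → ℂ) × ℂ) (i : ι) => (e.symm i).elim p.2 p.1 := by
  have h1 : MeasurePreserving (MeasurableEquiv.piOptionEquivProd fun _ : Option κ => ℂ).symm :=
    ⟨MeasurableEquiv.measurable _, Measure.pi_map_piOptionEquivProd fun _ : Option κ =>
      (volume : Measure ℂ)⟩
  have h2 := volume_measurePreserving_piCongrLeft (fun _ : ι => ℂ) e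
  have h := h2.comp h1
  suffices hfun : (fun (p : (κ → ℂ) × ℂ) (i : ι) => (e.symm i).elim p.2 p.1)
      = MeasurableEquiv.piCongrLeft (fun _ : ι => ℂ) e
        ∘ (MeasurableEquiv.piOptionEquivProd fun _ : Option κ => ℂ).symm by
    rw [hfun]; exact h
  funext p i
  obtain ⟨o, rfl⟩ := e.surjective i
  rw [Equiv.symm_apply_apply, Function.comp_apply, MeasurableEquiv.coe_piCongrLeft,
    Equiv.piCongrLeft_apply_apply]
  cases o <;> rfl

/-- The substitution is `α = √(a² + c) - a`. With `c` the squared norm of the other coordinates, `α`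
is the norm of the point minus its coordinate `a`. -/
theorem lintegral_real_eq_lintegral_Ioi {c : ℝ} (hc : 0 < c) (g : ℝ → ℝ≥0∞) :
    ∫⁻ a, g a = ∫⁻ α in Ioi (0 : ℝ),
      ENNReal.ofReal ((c / α ^ 2 + 1) / 2) * g ((c / α - α) / 2) := by
  have himg : (fun α : ℝ => (c / α - α) / 2) '' Ioi 0 = univ := by
    refine eq_univ_of_forall fun a => ⟨√(a ^ 2 + c) - a, ?_, ?_⟩
    · have : |a| < √(a ^ 2 + c) := by
        rw [← Real.sqrt_sq_eq_abs]; exact Real.sqrt_lt_sqrt (by positivity) (by linarith)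
      exact sub_pos.2 ((le_abs_self a).trans_lt this)
    · have h1 : |a| < √(a ^ 2 + c) := by
        rw [← Real.sqrt_sq_eq_abs]; exact Real.sqrt_lt_sqrt (by positivity) (by linarith)
      have h2 : 0 < √(a ^ 2 + c) - a := sub_pos.2 ((le_abs_self a).trans_lt h1)
      have h3 : √(a ^ 2 + c) ^ 2 = a ^ 2 + c := Real.sq_sqrt (by positivity)
      have h4 : c = (√(a ^ 2 + c) - a) * (√(a ^ 2 + c) + a) := by linear_combination -h3
      have h5 : c / (√(a ^ 2 + c) - a) = √(a ^ 2 + c) + a := by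
        rw [div_eq_iff h2.ne']; linarith
      simp only [h5]; ring
  have hinj : InjOn (fun α : ℝ => (c / α - α) / 2) (Ioi 0) := by
    refine StrictAntiOn.injOn fun x hx y hy hxy => ?_
    have : c / y < c / x := div_lt_div_of_pos_left hc hx hxy
    show (c / y - y) / 2 < (c / x - x) / 2
    linarith [show x < y from hxy]
  have hder : ∀ α ∈ Ioi (0 : ℝ), HasDerivWithinAt (fun α : ℝ => (c / α - α) / 2)
      (-((c / α ^ 2 + 1) / 2)) (Ioi 0) α := by
    intro α hα
    have hα : 0 < α := hα
    have := (((hasDerivAt_inv hα.ne').const_mul c).sub (hasDerivAt_id α)).div_const 2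
    refine HasDerivAt.hasDerivWithinAt ?_
    refine this.congr_deriv ?_
    rw [div_eq_mul_inv c]
    ring
  have := lintegral_image_eq_lintegral_abs_deriv_mul measurableSet_Ioi hder hinj g
  rw [himg, Measure.restrict_univ] at this
  rw [this]
  refine setLIntegral_congr_fun measurableSet_Ioi fun α hα => ?_
  have hα : 0 < α := hα
  rw [abs_neg, abs_of_pos (by positivity)]

theorem lintegral_complex_eq (f : ℂ → ℝ≥0∞) (hf : Measurable f) :
    ∫⁻ z, f z = ∫⁻ b : ℝ, ∫⁻ a : ℝ, f ⟨a, b⟩ := by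
  rw [← (Complex.volume_preserving_equiv_real_prod.symm).lintegral_comp_emb
    (MeasurableEquiv.measurableEmbedding _), Measure.volume_eq_prod,
    lintegral_prod_symm' (fun p : ℝ × ℝ => f (Complex.measurableEquivRealProd.symm p))
      (hf.comp (MeasurableEquiv.measurable _))]
  rfl

end ChangeOfVariables

/-! ### The parametrization of the sphere by `β` and `η`, and its density. -/

section SphereCoordinates

open Set
open scoped ENNReal

variable {κ : Type*} [Fintype κ]

/-- The square of the Euclidean norm of a complex vector. -/
noncomputable def sqNorm (y : κ → ℂ) : ℝ := ∑ j, ‖y j‖ ^ 2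

theorem sqNorm_nonneg (y : κ → ℂ) : 0 ≤ sqNorm y := Finset.sum_nonneg fun _ _ => by positivity

theorem sqNorm_smul (r : ℝ) (y : κ → ℂ) : sqNorm (r • y) = r ^ 2 * sqNorm y := by
  simp [sqNorm, mul_pow, Finset.mul_sum]

theorem measurable_sqNorm : Measurable (sqNorm : (κ → ℂ) → ℝ) := by
  unfold sqNorm; fun_prop

/-- The ratio of the norm to the height coordinate in the parametrization of the sphere. -/
noncomputable def sphereScale (β q : ℝ) : ℝ := (1 + β ^ 2) * (1 + q) / 2

/-- The distinguished coordinate `v_k` of the point of the unit sphere with the parameters `β`, `η`,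
where `q` is the squared norm of `η`. -/
noncomputable def sphereHead (β q : ℝ) : ℂ := 1 - (1 - β * Complex.I) / sphereScale β q

/-- The modulus of `1 - v_k` for the point of the unit sphere with the parameters `β`, `η`,
where `q` is the squared norm of `η`. The remaining coordinates are those of `η` times this. -/
noncomputable def sphereRatio (β q : ℝ) : ℝ := √(1 + β ^ 2) / sphereScale β q

/-- The density of the surface measure of the sphere in the parameters `β`, `η`. -/
noncomputable def sphereDensity (N : ℕ) (β q : ℝ) : ℝ :=
  (1 + β ^ 2) ^ N * (sphereScale β q ^ (2 * N + 1))⁻¹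

theorem sphereScale_pos (β : ℝ) {q : ℝ} (hq : 0 ≤ q) : 0 < sphereScale β q := by
  unfold sphereScale; positivity

theorem sphereDensity_pos (N : ℕ) (β : ℝ) {q : ℝ} (hq : 0 ≤ q) : 0 < sphereDensity N β q := by
  have := sphereScale_pos β hq
  unfold sphereDensity; positivity

theorem measurable_sphereScale : Measurable fun p : ℝ × ℝ => sphereScale p.1 p.2 := by
  unfold sphereScale; fun_prop

theorem measurable_sphereHead : Measurable fun p : ℝ × ℝ => sphereHead p.1 p.2 := by
  unfold sphereHead sphereScale
  fun_prop

theorem measurable_sphereRatio : Measurable fun p : ℝ × ℝ => sphereRatio p.1 p.2 := by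
  unfold sphereRatio sphereScale; fun_prop

theorem measurable_sphereDensity (N : ℕ) : Measurable fun p : ℝ × ℝ => sphereDensity N p.1 p.2 := by
  unfold sphereDensity sphereScale; fun_prop

theorem lintegral_Ioi_pow_of_mul_lt (m : ℕ) {M : ℝ} (hM : 0 < M) :
    ∫⁻ α in Ioi (0 : ℝ), (if α * M < 1 then ENNReal.ofReal (α ^ m) else 0)
      = ENNReal.ofReal ((M ^ (m + 1))⁻¹) * ∫⁻ u in Ioo (0 : ℝ) 1, ENNReal.ofReal (u ^ m) := by
  have hmeas : Measurable ((Ioo (0 : ℝ) 1).indicator fun u => ENNReal.ofReal (u ^ m)) :=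
    Measurable.indicator (by fun_prop) measurableSet_Ioo
  rw [← lintegral_indicator measurableSet_Ioo, ← lintegral_indicator measurableSet_Ioi,
    lintegral_eq_lintegral_comp_smul volume hmeas hM, ← mul_assoc,
    ← ENNReal.ofReal_mul (by positivity)]
  rw [← lintegral_const_mul _ (show Measurable fun x : ℝ =>
    (Ioo (0 : ℝ) 1).indicator (fun u => ENNReal.ofReal (u ^ m)) (M • x) from
    hmeas.comp (measurable_const_smul M))]
  refine lintegral_congr fun α => ?_
  simp only [indicator_apply, mem_Ioi, mem_Ioo, smul_eq_mul, Module.finrank_self, pow_one]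
  by_cases h0 : 0 < α
  · have h1 : 0 < M * α := mul_pos hM h0
    by_cases h : M * α < 1
    · rw [if_pos h0, if_pos (by rwa [mul_comm]), if_pos ⟨h1, h⟩,
        ← ENNReal.ofReal_mul (by positivity)]
      congr 1
      field_simp
      ring
    · rw [if_pos h0, if_neg (by rwa [mul_comm]), if_neg (fun h' => h h'.2), mul_zero]
  · rw [if_neg h0, if_neg (fun h' => h0 (pos_of_mul_pos_right h'.1 hM.le)), mul_zero]

/-- The function on the unit ball of `ℂ × ℂ^κ` that is constant on rays, in the coordinates given
by the imaginary and the real part of the first component. -/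
noncomputable def ballExtension (H : ℂ × (κ → ℂ) → ℝ≥0∞) (y : κ → ℂ) (b a : ℝ) : ℝ≥0∞ :=
  if a ^ 2 + b ^ 2 + sqNorm y < 1 then
    H ((√(a ^ 2 + b ^ 2 + sqNorm y))⁻¹ • (⟨a, b⟩ : ℂ), (√(a ^ 2 + b ^ 2 + sqNorm y))⁻¹ • y)
  else 0

theorem measurable_ballExtension {H : ℂ × (κ → ℂ) → ℝ≥0∞} (hH : Measurable H) :
    Measurable fun p : (κ → ℂ) × ℝ × ℝ => ballExtension H p.1 p.2.1 p.2.2 := by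
  have hq : Measurable fun p : (κ → ℂ) × ℝ × ℝ => p.2.2 ^ 2 + p.2.1 ^ 2 + sqNorm p.1 :=
    Measurable.add (by fun_prop) (measurable_sqNorm.comp measurable_fst)
  have hz : Measurable fun p : (κ → ℂ) × ℝ × ℝ => (⟨p.2.2, p.2.1⟩ : ℂ) :=
    Complex.measurableEquivRealProd.symm.measurable.comp
      (Measurable.prodMk (by fun_prop) (by fun_prop))
  refine Measurable.ite (measurableSet_lt hq measurable_const) (hH.comp ?_) measurable_const
  exact (hq.sqrt.inv.smul hz).prodMk (hq.sqrt.inv.smul measurable_fst)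

/-- For a point `(a + ib, y)` of norm `R` put `α = R - a`, `b = αβ` and `y = α √(1 + β²) η`. Then `R
= αM` and `a = α(M - 1)` with `M` the `sphereScale`, so `β` and `η` are constant on rays and `α` is
the radial variable. -/
theorem ballExtension_param (H : ℂ × (κ → ℂ) → ℝ≥0∞) {α : ℝ} (hα : 0 < α) (β : ℝ) (η : κ → ℂ) :
    ballExtension H ((α * √(1 + β ^ 2)) • η) (α * β)
      ((((α * β) ^ 2 + sqNorm ((α * √(1 + β ^ 2)) • η)) / α - α) / 2)
    = if α * sphereScale β (sqNorm η) < 1 then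
        H (sphereHead β (sqNorm η), sphereRatio β (sqNorm η) • η) else 0 := by
  have hM := sphereScale_pos β (sqNorm_nonneg η)
  set M := sphereScale β (sqNorm η) with hMdef
  have hs : √(1 + β ^ 2) ^ 2 = 1 + β ^ 2 := Real.sq_sqrt (by positivity)
  have hq : sqNorm ((α * √(1 + β ^ 2)) • η) = α ^ 2 * (1 + β ^ 2) * sqNorm η := by
    rw [sqNorm_smul, mul_pow, hs]
  have hM2 : (1 + β ^ 2) * (1 + sqNorm η) = 2 * M := by rw [hMdef, sphereScale]; ring
  have ha : (((α * β) ^ 2 + sqNorm ((α * √(1 + β ^ 2)) • η)) / α - α) / 2 = α * (M - 1) := by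
    rw [hq]
    have : (α * β) ^ 2 + α ^ 2 * (1 + β ^ 2) * sqNorm η = α ^ 2 * (2 * M - 1) := by
      linear_combination α ^ 2 * hM2
    rw [this]; field_simp; ring
  have hR : (α * (M - 1)) ^ 2 + (α * β) ^ 2 + sqNorm ((α * √(1 + β ^ 2)) • η) = (α * M) ^ 2 := by
    rw [hq]; linear_combination α ^ 2 * hM2
  have hαM : 0 < α * M := mul_pos hα hM
  rw [ballExtension, ha, hR, Real.sqrt_sq hαM.le]
  have hlt : (α * M) ^ 2 < 1 ↔ α * M < 1 := by
    rw [sq_lt_one_iff₀ hαM.le]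
  simp only [hlt]
  congr 3
  · rw [sphereHead, ← hMdef]
    have hMc : (M : ℂ) ≠ 0 := by exact_mod_cast hM.ne'
    have hαc : (α : ℂ) ≠ 0 := by exact_mod_cast hα.ne'
    have : (⟨α * (M - 1), α * β⟩ : ℂ) = α * ((M - 1) + β * Complex.I) := by
      apply Complex.ext <;> simp
    rw [this, Complex.real_smul]
    push_cast
    field_simp
    ring
  · rw [smul_smul, sphereRatio, ← hMdef]
    congr 1
    field_simp


theorem measurable_sphereDensity_mul (N : ℕ) {H : ℂ × (κ → ℂ) → ℝ≥0∞} (hH : Measurable H) :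
    Measurable fun p : ℝ × (κ → ℂ) => ENNReal.ofReal (sphereDensity N p.1 (sqNorm p.2)) *
      H (sphereHead p.1 (sqNorm p.2), sphereRatio p.1 (sqNorm p.2) • p.2) := by
  have hq : Measurable fun p : ℝ × (κ → ℂ) => (p.1, sqNorm p.2) :=
    measurable_fst.prodMk (measurable_sqNorm.comp measurable_snd)
  exact ((measurable_sphereDensity N).comp hq).ennreal_ofReal.mul
    (hH.comp ((measurable_sphereHead.comp hq).prodMk
      ((measurable_sphereRatio.comp hq).smul measurable_snd)))

/-- The substitutions for `a`, `b` and `y` have Jacobians `M`, `α` and `(α √(1 + β²))^(2N)`. The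
integral of `α^(2N + 1)` over `α < 1/M` contributes `M^(-(2N + 2))` up to a constant, which leaves
the density `(1 + β²)^N M^(-(2N + 1))`. -/
theorem lintegral_ballExtension (H : ℂ × (κ → ℂ) → ℝ≥0∞) (hH : Measurable H) :
    ∫⁻ y : κ → ℂ, ∫⁻ b : ℝ, ∫⁻ a : ℝ, ballExtension H y b a
      = (∫⁻ u in Ioo (0 : ℝ) 1, ENNReal.ofReal (u ^ (2 * Fintype.card κ + 1))) *
        ∫⁻ β : ℝ, ∫⁻ η : κ → ℂ,
          ENNReal.ofReal (sphereDensity (Fintype.card κ) β (sqNorm η)) *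
            H (sphereHead β (sqNorm η), sphereRatio β (sqNorm η) • η) := by
  set N := Fintype.card κ
  obtain ⟨Ψ, hΨ⟩ : ∃ Ψ : ℝ → (κ → ℂ) → ℝ → ℝ≥0∞, ∀ α y b, Ψ α y b =
    ENNReal.ofReal (((b ^ 2 + sqNorm y) / α ^ 2 + 1) / 2) *
      ballExtension H y b (((b ^ 2 + sqNorm y) / α - α) / 2) := ⟨_, fun _ _ _ => rfl⟩
  obtain ⟨Θ, hΘ⟩ : ∃ Θ : ℝ → ℝ → (κ → ℂ) → ℝ≥0∞, ∀ α β η, Θ α β η =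
    ENNReal.ofReal ((1 + β ^ 2) ^ N * sphereScale β (sqNorm η)) *
      H (sphereHead β (sqNorm η), sphereRatio β (sqNorm η) • η) *
      (if α * sphereScale β (sqNorm η) < 1 then ENNReal.ofReal (α ^ (2 * N + 1)) else 0) :=
    ⟨_, fun _ _ _ => rfl⟩
  have hE := measurable_ballExtension hH
  have hΨm : Measurable fun p : ℝ × (κ → ℂ) × ℝ => Ψ p.1 p.2.1 p.2.2 := by
    have hQ : Measurable fun p : ℝ × (κ → ℂ) × ℝ => sqNorm p.2.1 :=
      measurable_sqNorm.comp (measurable_fst.comp measurable_snd)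
    have hc : Measurable fun p : ℝ × (κ → ℂ) × ℝ => p.2.2 ^ 2 + sqNorm p.2.1 :=
      Measurable.add (by fun_prop) hQ
    have hφ : Measurable fun p : ℝ × (κ → ℂ) × ℝ =>
        (p.2.1, p.2.2, ((p.2.2 ^ 2 + sqNorm p.2.1) / p.1 - p.1) / 2) :=
      (measurable_fst.comp measurable_snd).prodMk
        ((measurable_snd.comp measurable_snd).prodMk
          (((hc.div measurable_fst).sub measurable_fst).div_const 2))
    have hJ : Measurable fun p : ℝ × (κ → ℂ) × ℝ =>
        ENNReal.ofReal (((p.2.2 ^ 2 + sqNorm p.2.1) / p.1 ^ 2 + 1) / 2) :=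
      (((hc.div (measurable_fst.pow_const 2)).add_const 1).div_const 2).ennreal_ofReal
    simp only [hΨ]
    exact hJ.mul (hE.comp hφ)
  have hq2 : Measurable fun p : ℝ × ℝ × (κ → ℂ) => (p.2.1, sqNorm p.2.2) :=
    (measurable_fst.comp measurable_snd).prodMk
      (measurable_sqNorm.comp (measurable_snd.comp measurable_snd))
  have hH2 : Measurable fun p : ℝ × ℝ × (κ → ℂ) =>
      H (sphereHead p.2.1 (sqNorm p.2.2), sphereRatio p.2.1 (sqNorm p.2.2) • p.2.2) :=
    hH.comp ((measurable_sphereHead.comp hq2).prodMk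
      ((measurable_sphereRatio.comp hq2).smul (measurable_snd.comp measurable_snd)))
  have hS2 : Measurable fun p : ℝ × ℝ × (κ → ℂ) => sphereScale p.2.1 (sqNorm p.2.2) :=
    measurable_sphereScale.comp hq2
  have hΘm : Measurable fun p : ℝ × ℝ × (κ → ℂ) => Θ p.1 p.2.1 p.2.2 := by
    simp only [hΘ]
    refine Measurable.mul (Measurable.mul (by fun_prop) hH2) (Measurable.ite ?_ (by fun_prop)
      measurable_const)
    exact measurableSet_lt (measurable_fst.mul hS2) measurable_const
  have h1 : ∀ y : κ → ℂ, ∫⁻ b : ℝ, ∫⁻ a : ℝ, ballExtension H y b a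
      = ∫⁻ b : ℝ, ∫⁻ α in Ioi (0 : ℝ), Ψ α y b := by
    intro y
    -- The substitution for `a` needs `b² + |y|² > 0`; discarding `b = 0` ensures this for every
    -- `y`.
    have h0 : ∀ᵐ b : ℝ, b ≠ 0 := by simp [ae_iff, measure_singleton]
    refine lintegral_congr_ae (h0.mono fun b hb => ?_)
    simp only [hΨ]
    exact lintegral_real_eq_lintegral_Ioi
      (add_pos_of_pos_of_nonneg (by positivity) (sqNorm_nonneg y)) _
  have h2 : ∀ y : κ → ℂ, ∫⁻ b : ℝ, ∫⁻ α in Ioi (0 : ℝ), Ψ α y b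
      = ∫⁻ α in Ioi (0 : ℝ), ∫⁻ b : ℝ, Ψ α y b := by
    intro y
    refine lintegral_lintegral_swap (Measurable.aemeasurable ?_)
    exact hΨm.comp (by fun_prop : Measurable fun p : ℝ × ℝ => (p.2, y, p.1))
  have h3 : ∫⁻ y : κ → ℂ, ∫⁻ α in Ioi (0 : ℝ), ∫⁻ b : ℝ, Ψ α y b
      = ∫⁻ α in Ioi (0 : ℝ), ∫⁻ y : κ → ℂ, ∫⁻ b : ℝ, Ψ α y b := by
    refine lintegral_lintegral_swap (Measurable.aemeasurable ?_)
    exact Measurable.lintegral_prod_right' (f := fun p : ((κ → ℂ) × ℝ) × ℝ => Ψ p.1.2 p.1.1 p.2)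
      (hΨm.comp (by fun_prop : Measurable fun p : ((κ → ℂ) × ℝ) × ℝ => (p.1.2, p.1.1, p.2)))
  have h4 : ∀ α ∈ Ioi (0 : ℝ), ∫⁻ y : κ → ℂ, ∫⁻ b : ℝ, Ψ α y b
      = ∫⁻ β : ℝ, ∫⁻ η : κ → ℂ, Θ α β η := by
    intro α hα
    have hα : 0 < α := hα
    have hb : ∀ y : κ → ℂ, ∫⁻ b : ℝ, Ψ α y b = ∫⁻ β : ℝ, ENNReal.ofReal α * Ψ α y (α * β) := by
      intro y
      have hm : Measurable (Ψ α y) :=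
        hΨm.comp (by fun_prop : Measurable fun b : ℝ => (α, y, b))
      rw [lintegral_eq_lintegral_comp_smul volume hm hα, lintegral_const_mul]
      · simp
      · exact hm.comp (measurable_const_mul α)
    rw [lintegral_congr hb, lintegral_lintegral_swap (Measurable.aemeasurable ?_)]
    swap
    · exact measurable_const.mul (hΨm.comp (by fun_prop : Measurable fun p : (κ → ℂ) × ℝ =>
        (α, p.1, α * p.2)))
    refine lintegral_congr fun β => ?_
    have hm : Measurable fun y : κ → ℂ => ENNReal.ofReal α * Ψ α y (α * β) :=
      measurable_const.mul (hΨm.comp (by fun_prop : Measurable fun y : κ → ℂ => (α, y, α * β)))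
    have hs : √(1 + β ^ 2) ^ 2 = 1 + β ^ 2 := Real.sq_sqrt (by positivity)
    have hr : 0 < α * √(1 + β ^ 2) := by positivity
    rw [lintegral_pi_eq_lintegral_comp_smul hm hr, ← lintegral_const_mul]
    swap
    · exact hm.comp (measurable_const_smul _)
    refine lintegral_congr fun η => ?_
    simp only [hΨ, hΘ]
    rw [ballExtension_param H hα]
    have hM := sphereScale_pos β (sqNorm_nonneg η)
    -- The Jacobian of the substitution for `a` does not depend on `α`.
    have hJ : (((α * β) ^ 2 + sqNorm ((α * √(1 + β ^ 2)) • η)) / α ^ 2 + 1) / 2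
        = sphereScale β (sqNorm η) := by
      rw [sqNorm_smul, mul_pow, mul_pow, hs, sphereScale]
      field_simp
      ring
    rw [hJ]
    split_ifs with h
    · rw [← mul_assoc, ← mul_assoc, ← ENNReal.ofReal_mul (by positivity),
        ← ENNReal.ofReal_mul (by positivity), mul_right_comm _ (H _),
        ← ENNReal.ofReal_mul (by positivity)]
      congr 2
      rw [mul_pow, pow_mul (√(1 + β ^ 2)), hs]
      ring
    · simp
  have h5 : ∫⁻ α in Ioi (0 : ℝ), ∫⁻ β : ℝ, ∫⁻ η : κ → ℂ, Θ α β η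
      = ∫⁻ β : ℝ, ∫⁻ η : κ → ℂ, ∫⁻ α in Ioi (0 : ℝ), Θ α β η := by
    rw [lintegral_lintegral_swap]
    · refine lintegral_congr fun β => lintegral_lintegral_swap (Measurable.aemeasurable ?_)
      exact hΘm.comp (by fun_prop : Measurable fun p : ℝ × (κ → ℂ) => (p.1, β, p.2))
    · refine Measurable.aemeasurable ?_
      exact Measurable.lintegral_prod_right' (f := fun p : (ℝ × ℝ) × (κ → ℂ) => Θ p.1.1 p.1.2 p.2)
        (hΘm.comp (by fun_prop : Measurable fun p : (ℝ × ℝ) × (κ → ℂ) => (p.1.1, p.1.2, p.2)))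
  obtain ⟨Ξ, hΞ⟩ : ∃ Ξ : ℝ → (κ → ℂ) → ℝ≥0∞, ∀ β η, Ξ β η =
    ENNReal.ofReal (sphereDensity N β (sqNorm η)) *
      H (sphereHead β (sqNorm η), sphereRatio β (sqNorm η) • η) := ⟨_, fun _ _ => rfl⟩
  have hΞm : Measurable fun p : ℝ × (κ → ℂ) => Ξ p.1 p.2 := by
    simp only [hΞ]
    exact measurable_sphereDensity_mul N hH
  simp only [← hΞ]
  rw [lintegral_congr h1, lintegral_congr h2, h3, setLIntegral_congr_fun measurableSet_Ioi h4, h5,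
    ← lintegral_const_mul _ (Measurable.lintegral_prod_right' hΞm)]
  refine lintegral_congr fun β => ?_
  have hΞβ : Measurable fun η => Ξ β η :=
    hΞm.comp (by fun_prop : Measurable fun η : κ → ℂ => (β, η))
  dsimp only
  rw [← lintegral_const_mul _ hΞβ]
  refine lintegral_congr fun η => ?_
  have hM := sphereScale_pos β (sqNorm_nonneg η)
  have hif : Measurable fun α : ℝ => if α * sphereScale β (sqNorm η) < 1 then
      ENNReal.ofReal (α ^ (2 * N + 1)) else 0 :=
    Measurable.ite (measurableSet_lt (by fun_prop) measurable_const) (by fun_prop) measurable_const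
  have h6 : ∫⁻ α in Ioi (0 : ℝ), Θ α β η
      = ENNReal.ofReal ((1 + β ^ 2) ^ N * sphereScale β (sqNorm η)) *
        H (sphereHead β (sqNorm η), sphereRatio β (sqNorm η) • η) *
        ∫⁻ α in Ioi (0 : ℝ), (if α * sphereScale β (sqNorm η) < 1 then
          ENNReal.ofReal (α ^ (2 * N + 1)) else 0) := by
    simp only [hΘ]
    exact lintegral_const_mul _ hif
  have h7 : sphereDensity N β (sqNorm η) = (1 + β ^ 2) ^ N * sphereScale β (sqNorm η) *
      (sphereScale β (sqNorm η) ^ (2 * N + 1 + 1))⁻¹ := by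
    rw [sphereDensity, pow_succ _ (2 * N + 1)]
    field_simp
  rw [h6, lintegral_Ioi_pow_of_mul_lt _ hM, hΞ, h7,
    ENNReal.ofReal_mul (p := (1 + β ^ 2) ^ N * sphereScale β (sqNorm η)) (by positivity)]
  ac_rfl

end SphereCoordinates

/-! ### Unitary matrices fixing initial basis vectors, and conjugation of rank-one perturbations. -/

section Unitary

open Matrix

variable {n : ℕ}

/-- The subgroup of the unitary matrices that fix the first `k` vectors of the standard basis. -/
def headFixing (n k : ℕ) : Subgroup (unitaryGroup (Fin n) ℂ) where
  carrier := {g | ∀ j : Fin n, (j : ℕ) < k →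
    (g : Matrix (Fin n) (Fin n) ℂ) *ᵥ Pi.single j 1 = Pi.single j 1}
  one_mem' := fun j _ => by rw [OneMemClass.coe_one, one_mulVec]
  mul_mem' := by
    intro a b ha hb j hj
    rw [Submonoid.coe_mul, ← mulVec_mulVec, hb j hj, ha j hj]
  inv_mem' := by
    intro a ha j hj
    have h : ((a⁻¹ * a : unitaryGroup (Fin n) ℂ) : Matrix (Fin n) (Fin n) ℂ)
        *ᵥ Pi.single j 1 = Pi.single j 1 := by
      rw [inv_mul_cancel, OneMemClass.coe_one, one_mulVec]
    rwa [Submonoid.coe_mul, ← mulVec_mulVec, ha j hj] at h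

theorem headFixing_anti (n : ℕ) {k l : ℕ} (h : k ≤ l) : headFixing n l ≤ headFixing n k :=
  fun _ hg j hj => hg j (hj.trans_le h)

theorem headFixing_zero (n : ℕ) (g : unitaryGroup (Fin n) ℂ) : g ∈ headFixing n 0 :=
  fun _ hj => absurd hj (Nat.not_lt_zero _)

theorem apply_right_of_mem_headFixing {k : ℕ} {g : unitaryGroup (Fin n) ℂ}
    (hg : g ∈ headFixing n k) (i : Fin n) {j : Fin n} (hj : (j : ℕ) < k) :
    (g : Matrix (Fin n) (Fin n) ℂ) i j = (Pi.single j 1 : Fin n → ℂ) i := by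
  have := congrFun (hg j hj) i
  simpa using this

/-- The inverse fixes the same basis vectors and is the adjoint, so the statement on columns
transfers to rows. -/
theorem apply_left_of_mem_headFixing {k : ℕ} {g : unitaryGroup (Fin n) ℂ}
    (hg : g ∈ headFixing n k) {i : Fin n} (j : Fin n) (hi : (i : ℕ) < k) :
    (g : Matrix (Fin n) (Fin n) ℂ) i j = (Pi.single i 1 : Fin n → ℂ) j := by
  have h := apply_right_of_mem_headFixing (inv_mem hg) j hi
  have h2 : ((g⁻¹ : unitaryGroup (Fin n) ℂ) : Matrix (Fin n) (Fin n) ℂ) j i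
      = star ((g : Matrix (Fin n) (Fin n) ℂ) i j) := rfl
  rw [h2] at h
  rw [← star_star ((g : Matrix (Fin n) (Fin n) ℂ) i j), h]
  by_cases hij : j = i
  · subst hij; simp
  · simp [hij]

theorem mulVec_apply_of_mem_headFixing {k : ℕ} {g : unitaryGroup (Fin n) ℂ}
    (hg : g ∈ headFixing n k) (v : Fin n → ℂ) {i : Fin n} (hi : (i : ℕ) < k) :
    ((g : Matrix (Fin n) (Fin n) ℂ) *ᵥ v) i = v i := by
  rw [mulVec, dotProduct, Finset.sum_congr rfl fun j _ => by
    rw [apply_left_of_mem_headFixing hg j hi]]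
  simp [Pi.single_apply]

theorem mulVec_eq_self_of_mem_headFixing {k : ℕ} {g : unitaryGroup (Fin n) ℂ}
    (hg : g ∈ headFixing n k) {z : Fin n → ℂ} (hz : ∀ j : Fin n, k ≤ j → z j = 0) :
    (g : Matrix (Fin n) (Fin n) ℂ) *ᵥ z = z := by
  funext i
  rw [mulVec, dotProduct]
  have : ∀ j, (g : Matrix (Fin n) (Fin n) ℂ) i j * z j = (Pi.single j 1 : Fin n → ℂ) i * z j := by
    intro j
    rcases lt_or_ge (j : ℕ) k with hj | hj
    · rw [apply_right_of_mem_headFixing hg i hj]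
    · rw [hz j hj, mul_zero, mul_zero]
  rw [Finset.sum_congr rfl fun j _ => this j]
  simp [Pi.single_apply]

theorem star_mulVec_dotProduct_mulVec (g : unitaryGroup (Fin n) ℂ) (v w : Fin n → ℂ) :
    star ((g : Matrix (Fin n) (Fin n) ℂ) *ᵥ v) ⬝ᵥ ((g : Matrix (Fin n) (Fin n) ℂ) *ᵥ w)
      = star v ⬝ᵥ w := by
  rw [star_mulVec, ← dotProduct_mulVec, mulVec_mulVec]
  have : (g : Matrix (Fin n) (Fin n) ℂ)ᴴ * (g : Matrix (Fin n) (Fin n) ℂ) = 1 :=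
    Unitary.coe_star_mul_self g
  rw [this, one_mulVec]

theorem conj_one_sub_smul_vecMulVec (g : unitaryGroup (Fin n) ℂ) (c : ℂ) (p : Fin n → ℂ) :
    (g : Matrix (Fin n) (Fin n) ℂ) * (1 - c • vecMulVec p (star p)) *
        star (g : Matrix (Fin n) (Fin n) ℂ)
      = 1 - c • vecMulVec ((g : Matrix (Fin n) (Fin n) ℂ) *ᵥ p)
          (star ((g : Matrix (Fin n) (Fin n) ℂ) *ᵥ p)) := by
  have hg : (g : Matrix (Fin n) (Fin n) ℂ) * star (g : Matrix (Fin n) (Fin n) ℂ) = 1 :=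
    Unitary.coe_mul_star_self g
  rw [mul_sub, sub_mul, mul_one, hg, mul_smul_comm, smul_mul_assoc,
    mul_vecMulVec, vecMulVec_mul, star_mulVec, star_eq_conjTranspose]

/-- Two vectors of the same norm are related by a unitary complex reflection along their
difference. -/
theorem exists_unitary_mulVec_eq {p q : Fin n → ℂ} (h : star p ⬝ᵥ p = star q ⬝ᵥ q) :
    ∃ (g : unitaryGroup (Fin n) ℂ) (c : ℂ), (g : Matrix (Fin n) (Fin n) ℂ) *ᵥ p = q ∧
      (g : Matrix (Fin n) (Fin n) ℂ) = 1 - c • vecMulVec (p - q) (star (p - q)) := by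
  set d := star (p - q) ⬝ᵥ p with hd
  have hstar : star d = star p ⬝ᵥ (p - q) := by
    rw [hd, ← star_dotProduct_star, star_star, dotProduct_comm]
  have hzz : star (p - q) ⬝ᵥ (p - q) = d + star d := by
    rw [hstar, hd, star_sub, sub_dotProduct, dotProduct_sub, dotProduct_sub, sub_dotProduct, h]
    ring
  by_cases h0 : d = 0
  -- For vectors of equal norm `|p - q|² = d + conj d`, so `d = 0` forces `p = q`.
  · have hz : p - q = 0 := by
      rw [h0, star_zero, add_zero] at hzz
      open scoped ComplexOrder in exact dotProduct_star_self_eq_zero.1 hzz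
    refine ⟨1, 0, ?_, by simp⟩
    rw [OneMemClass.coe_one, one_mulVec]
    exact sub_eq_zero.1 hz
  have h0' : star d ≠ 0 := star_ne_zero.2 h0
  -- The same identity `|p - q|² = d + conj d` makes the quadratic term cancel the two linear ones.
  have hmem : (1 - d⁻¹ • vecMulVec (p - q) (star (p - q)) : Matrix (Fin n) (Fin n) ℂ)
      ∈ unitaryGroup (Fin n) ℂ := by
    rw [mem_unitaryGroup_iff]
    generalize p - q = w at hzz
    have hs : star (vecMulVec w (star w)) = vecMulVec w (star w) := by
      rw [star_eq_conjTranspose, conjTranspose_vecMulVec, star_star]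
    rw [star_sub, star_one, star_smul, hs, star_inv₀, sub_mul, mul_sub,
      mul_sub, one_mul, mul_one, one_mul, smul_mul_smul_comm, vecMulVec_mul_vecMulVec, hzz,
      vecMulVec_smul, smul_smul]
    have : d⁻¹ * (star d)⁻¹ * (d + star d) = d⁻¹ + (star d)⁻¹ := by field_simp; ring
    rw [this, add_smul]
    abel
  refine ⟨⟨_, hmem⟩, d⁻¹, ?_, rfl⟩
  rw [sub_mulVec, one_mulVec, smul_mulVec, vecMulVec_mulVec, ← hd]
  simp [smul_smul, h0]

/-- The reflection of a unit vector as a unitary matrix, and the identity for other vectors. -/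
noncomputable def unitaryReflection (k : Fin n) (v : Fin n → ℂ) : unitaryGroup (Fin n) ℂ :=
  open Classical in
  if hv : star v ⬝ᵥ v = 1 then ⟨reflectionMatrix k v, reflectionMatrix_mem k v hv⟩ else 1

theorem coe_unitaryReflection (k : Fin n) {v : Fin n → ℂ} (hv : star v ⬝ᵥ v = 1) :
    (unitaryReflection k v : Matrix (Fin n) (Fin n) ℂ) = reflectionMatrix k v := by
  rw [unitaryReflection, dif_pos hv]

theorem reflection_eq_unitaryReflection (k : Fin n) (x : Metric.sphere (0 : TailSpace k) 1) :
    reflection k x = unitaryReflection k (extendZero k x) :=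
  Subtype.ext (coe_unitaryReflection k (extendZero_dotProduct k x)).symm

theorem measurable_unitaryReflection (k : Fin n) :
    Measurable (unitaryReflection k : (Fin n → ℂ) → unitaryGroup (Fin n) ℂ) := by
  classical
  have hst : Measurable (star : ℂ → ℂ) := Complex.continuous_conj.measurable
  have hS : MeasurableSet {v : Fin n → ℂ | star v ⬝ᵥ v = 1} := by
    refine measurableSet_eq_fun ?_ measurable_const
    simp only [dotProduct, Pi.star_apply]
    exact Finset.measurable_sum _ fun i _ =>
      (hst.comp (measurable_pi_apply i)).mul (measurable_pi_apply i)
  refine measurable_unitary_mk fun i j => ?_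
  have : (fun v => (unitaryReflection k v : Matrix (Fin n) (Fin n) ℂ) i j) = fun v =>
      if star v ⬝ᵥ v = 1 then reflectionMatrix k v i j else (1 : Matrix (Fin n) (Fin n) ℂ) i j := by
    funext v
    by_cases hv : star v ⬝ᵥ v = 1
    · rw [coe_unitaryReflection k hv, if_pos hv]
    · rw [unitaryReflection, dif_neg hv, if_neg hv]; rfl
  rw [this]
  refine Measurable.ite hS ?_ measurable_const
  simp only [reflectionMatrix, Matrix.sub_apply, Matrix.smul_apply, vecMulVec_apply,
    Pi.sub_apply, Pi.star_apply, smul_eq_mul]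
  exact measurable_const.sub
    (((measurable_const.sub (hst.comp (measurable_pi_apply k))).inv).mul
    (((measurable_pi_apply i).sub measurable_const).mul
      (hst.comp ((measurable_pi_apply j).sub measurable_const))))

theorem reflectionMatrix_apply_self (k : Fin n) (v : Fin n → ℂ) :
    reflectionMatrix k v k k = v k := by
  by_cases h : 1 - star (v k) = 0
  · have : v k = 1 := by
      rw [← star_star (v k), ← sub_eq_zero.1 h, star_one]
    simp [reflectionMatrix, this]
  · have h' : 1 - (starRingEnd ℂ) (v k) ≠ 0 := h
    simp [reflectionMatrix, vecMulVec_apply]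
    field_simp
    ring

theorem reflectionMatrix_mulVec_single (k : Fin n) {v : Fin n → ℂ} {j : Fin n} (hjk : j ≠ k)
    (hv : v j = 0) : reflectionMatrix k v *ᵥ Pi.single j 1 = Pi.single j 1 := by
  rw [reflectionMatrix, sub_mulVec, one_mulVec, smul_mulVec, vecMulVec_mulVec]
  simp [hjk, hv]

theorem reflection_mem_headFixing (k : Fin n) (x : Metric.sphere (0 : TailSpace k) 1) :
    reflection k x ∈ headFixing n k := by
  intro j hj
  refine reflectionMatrix_mulVec_single k (Fin.ne_of_lt hj) ?_
  rw [extendZero, dif_neg (not_le.2 (Fin.lt_def.2 hj))]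

theorem reflectionMatrix_mulVec {k : Fin n} {h : unitaryGroup (Fin n) ℂ}
    (hh : h ∈ headFixing n (k + 1)) (v : Fin n → ℂ) :
    reflectionMatrix k ((h : Matrix (Fin n) (Fin n) ℂ) *ᵥ v)
      = (h : Matrix (Fin n) (Fin n) ℂ) * reflectionMatrix k v *
        star (h : Matrix (Fin n) (Fin n) ℂ) := by
  rw [reflectionMatrix, reflectionMatrix, conj_one_sub_smul_vecMulVec, mulVec_sub,
    hh k (Nat.lt_succ_self _), mulVec_apply_of_mem_headFixing hh v (Nat.lt_succ_self _)]

/-- Two matrices of the form `1 - ω p p*` with vectors `p` of the same norm which differ only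
in coordinates fixed by `B` give conjugate products with `B`. -/
theorem exists_conj_of_one_sub_smul_vecMulVec {k l : ℕ} {B r r' : unitaryGroup (Fin n) ℂ}
    (hB : B ∈ headFixing n l) {ω : ℂ} {p q : Fin n → ℂ}
    (hr : (r : Matrix (Fin n) (Fin n) ℂ) = 1 - ω • vecMulVec p (star p))
    (hr' : (r' : Matrix (Fin n) (Fin n) ℂ) = 1 - ω • vecMulVec q (star q))
    (hpq : star p ⬝ᵥ p = star q ⬝ᵥ q) (hlo : ∀ j : Fin n, (j : ℕ) < k → p j = q j)
    (hhi : ∀ j : Fin n, l ≤ j → p j = q j) :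
    ∃ g ∈ headFixing n k, r' * B = g * (r * B) * g⁻¹ := by
  obtain ⟨g, c, hgp, hg⟩ := exists_unitary_mulVec_eq hpq
  have hz : ∀ j : Fin n, l ≤ j → (p - q) j = 0 := fun j hj => by
    rw [Pi.sub_apply, hhi j hj, sub_self]
  -- Conjugating `g` by `B` replaces `p - q` by `B (p - q)`, and `B` fixes `p - q`, which is
  -- supported on the coordinates below `l`.
  have hgB : B * g = g * B := by
    have hconj : (B : Matrix (Fin n) (Fin n) ℂ) * g * star (B : Matrix (Fin n) (Fin n) ℂ) = g := by
      rw [hg, conj_one_sub_smul_vecMulVec, mulVec_eq_self_of_mem_headFixing hB hz]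
    have : B * g * B⁻¹ = g := Subtype.ext hconj
    exact mul_inv_eq_iff_eq_mul.1 this
  refine ⟨g, fun j hj => ?_, ?_⟩
  · have h0 : (p - q) j = 0 := by rw [Pi.sub_apply, hlo j hj, sub_self]
    rw [hg, sub_mulVec, one_mulVec, smul_mulVec, vecMulVec_mulVec, dotProduct_single,
      Pi.star_apply, h0]
    simp
  · have h1 : r' = g * r * g⁻¹ := by
      refine Subtype.ext ?_
      change (r' : Matrix (Fin n) (Fin n) ℂ)
        = (g : Matrix (Fin n) (Fin n) ℂ) * r * star (g : Matrix (Fin n) (Fin n) ℂ)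
      rw [hr, hr', conj_one_sub_smul_vecMulVec, hgp]
    have h2 : g⁻¹ * B = B * g⁻¹ := by
      rw [inv_mul_eq_iff_eq_mul, ← mul_assoc, ← hgB]; group
    rw [h1, mul_assoc, h2]; group

end Unitary

/-! ### The uniform measure on the sphere in the parameters. -/

section UniformSphere

open Set
open scoped ENNReal

variable {n : ℕ}

/-- The vector with the coordinate `z` at `k`, the coordinates `y` behind `k`, and zeros before. -/
noncomputable def tailVec (k : Fin n) (z : ℂ) (y : {j : Fin n // k < j} → ℂ) : Fin n → ℂ :=
  fun j => if j = k then z else if h : k < j then y ⟨j, h⟩ else 0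

theorem tailVec_self (k : Fin n) (z : ℂ) (y : {j : Fin n // k < j} → ℂ) : tailVec k z y k = z :=
  if_pos rfl

theorem tailVec_of_lt {k j : Fin n} (z : ℂ) (y : {j : Fin n // k < j} → ℂ) (h : k < j) :
    tailVec k z y j = y ⟨j, h⟩ := by
  rw [tailVec, if_neg h.ne', dif_pos h]

theorem tailVec_of_gt {k j : Fin n} (z : ℂ) (y : {j : Fin n // k < j} → ℂ) (h : j < k) :
    tailVec k z y j = 0 := by
  rw [tailVec, if_neg h.ne, dif_neg h.not_gt]

theorem measurable_tailVec (k : Fin n) :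
    Measurable fun p : ℂ × ({j : Fin n // k < j} → ℂ) => tailVec k p.1 p.2 := by
  refine measurable_pi_iff.2 fun j => ?_
  rcases lt_trichotomy j k with h | h | h
  · simp only [tailVec_of_gt _ _ h]; exact measurable_const
  · subst h; simp only [tailVec_self]; exact measurable_fst
  · simp only [tailVec_of_lt _ _ h]; fun_prop

/-- The point of the unit sphere with the parameters `β` and `η`. -/
noncomputable def tailPoint (k : Fin n) (β : ℝ) (η : {j : Fin n // k < j} → ℂ) : Fin n → ℂ :=
  tailVec k (sphereHead β (sqNorm η)) (sphereRatio β (sqNorm η) • η)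

/-- The coordinates from `k` on are `k` and the ones behind it. -/
def optionTailEquiv (k : Fin n) : Option {j : Fin n // k < j} ≃ {j : Fin n // k ≤ j} where
  toFun o := o.elim ⟨k, le_rfl⟩ fun j => ⟨j, j.2.le⟩
  invFun j := if h : k < j then some ⟨j, h⟩ else none
  left_inv o := by
    cases o with
    | none => simp
    | some j => simp [j.2]
  right_inv j := by
    by_cases h : k < j.1
    · simp [h]
    · have : k = j.1 := le_antisymm j.2 (not_lt.1 h)
      simp only [h, dite_false, Option.elim]
      exact Subtype.ext this

/-- The coordinates behind `k` are `k + 1` and the ones behind it. -/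
def optionShiftEquiv {k k' : Fin n} (hk : (k' : ℕ) = k + 1) :
    Option {j : Fin n // k' < j} ≃ {j : Fin n // k < j} where
  toFun o := o.elim ⟨k', Fin.lt_def.2 (by omega)⟩ fun j =>
    ⟨j, Fin.lt_def.2 (by have := Fin.lt_def.1 j.2; omega)⟩
  invFun j := if h : k' < j then some ⟨j, h⟩ else none
  left_inv o := by
    cases o with
    | none => simp
    | some j => simp [j.2]
  right_inv j := by
    by_cases h : k' < j.1
    · simp [h]
    · have : k' = j.1 := by
        have h1 := Fin.lt_def.1 j.2
        rw [Fin.lt_def] at h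
        exact Fin.ext (by omega)
      simp only [h, dite_false, Option.elim]
      exact Subtype.ext this

theorem elim_optionTailEquiv_symm (k : Fin n) (z : ℂ) (y : {j : Fin n // k < j} → ℂ)
    (j : {j : Fin n // k ≤ j}) :
    ((optionTailEquiv k).symm j).elim z y = tailVec k z y j := by
  obtain ⟨o, rfl⟩ := (optionTailEquiv k).surjective j
  rw [Equiv.symm_apply_apply]
  cases o with
  | none => exact (tailVec_self k z y).symm
  | some j => exact (tailVec_of_lt z y j.2).symm

theorem measurable_extendZero (k : Fin n) : Measurable (extendZero k) := by
  refine measurable_pi_iff.2 fun j => ?_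
  unfold extendZero
  by_cases h : k ≤ j
  · simp only [h, dite_true]; fun_prop
  · simp [h]

theorem extendZero_elim (k : Fin n) (z : ℂ) (y : {j : Fin n // k < j} → ℂ) (r : ℝ) :
    extendZero k (r • WithLp.toLp 2 fun j => ((optionTailEquiv k).symm j).elim z y)
      = tailVec k (r • z) (r • y) := by
  funext j
  simp only [elim_optionTailEquiv_symm]
  rcases lt_trichotomy j k with h | h | h
  · rw [tailVec_of_gt _ _ h, extendZero, dif_neg h.not_ge]
  · subst h; rw [tailVec_self, extendZero, dif_pos le_rfl]; simp [tailVec_self]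
  · rw [tailVec_of_lt _ _ h, extendZero, dif_pos h.le]; simp [tailVec_of_lt _ _ h]

theorem norm_elim (k : Fin n) (a b : ℝ) (y : {j : Fin n // k < j} → ℂ) :
    ‖(WithLp.toLp 2 fun j => ((optionTailEquiv k).symm j).elim (⟨a, b⟩ : ℂ) y : TailSpace k)‖
      = √(a ^ 2 + b ^ 2 + sqNorm y) := by
  rw [EuclideanSpace.norm_eq]
  congr 1
  rw [← Fintype.sum_equiv (optionTailEquiv k)
    (fun o => ‖o.elim (⟨a, b⟩ : ℂ) y‖ ^ 2) _ (fun o => by simp), Fintype.sum_option]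
  have h : ‖(⟨a, b⟩ : ℂ)‖ ^ 2 = a ^ 2 + b ^ 2 := by
    rw [Complex.sq_norm, Complex.normSq_apply]; ring
  simp [sqNorm, h]

instance nontrivial_tailSpace (k : Fin n) : Nontrivial (TailSpace k) :=
  ⟨⟨0, EuclideanSpace.single ⟨k, le_rfl⟩ 1, fun h => by
    have := congrArg (fun x : TailSpace k => x ⟨k, le_rfl⟩) h
    simp at this⟩⟩

/-- The surface integral becomes an integral over the ball, to which `lintegral_ballExtension`
applies. The Euclidean volume and the product volume are compared only up to a scalar, by uniqueness
of Haar measure. All constants go into `C`, which is eliminated later by comparing total masses. -/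
theorem exists_lintegral_uniformSphere (k : Fin n) : ∃ C : ℝ≥0∞, ∀ F : (Fin n → ℂ) → ℝ≥0∞,
    Measurable F → ∫⁻ x : Metric.sphere (0 : TailSpace k) 1, F (extendZero k x) ∂uniformSphere k
      = C * ∫⁻ β : ℝ, ∫⁻ η : {j : Fin n // k < j} → ℂ,
          ENNReal.ofReal (sphereDensity (Fintype.card {j : Fin n // k < j}) β (sqNorm η)) *
            F (tailPoint k β η) := by
  obtain ⟨C₁, hC₁⟩ := lintegral_toSphere (volume : Measure (TailSpace k))
  set φ := (PiLp.continuousLinearEquiv 2 ℝ fun _ : {j : Fin n // k ≤ j} => ℂ) with hφ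
  have hHaar : ((volume : Measure (TailSpace k)).map φ).IsAddHaarMeasure :=
    φ.isAddHaarMeasure_map volume
  set c := Measure.addHaarScalarFactor ((volume : Measure (TailSpace k)).map φ) volume with hc
  have hmap : (volume : Measure (TailSpace k)).map φ = c • volume :=
    Measure.isAddLeftInvariant_eq_smul _ _
  refine ⟨((volume : Measure (TailSpace k)).toSphere univ)⁻¹ * (C₁ * (c *
    ∫⁻ u in Ioo (0 : ℝ) 1, ENNReal.ofReal (u ^ (2 * Fintype.card {j : Fin n // k < j} + 1)))),
    fun F hF => ?_⟩
  set G : TailSpace k → ℝ≥0∞ := fun x => F (extendZero k x) with hG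
  have hGm : Measurable G := hF.comp (measurable_extendZero k)
  set g : ({j : Fin n // k ≤ j} → ℂ) → ℝ≥0∞ := fun y =>
    (Metric.ball (0 : TailSpace k) 1).indicator (fun x => G (‖x‖⁻¹ • x)) (WithLp.toLp 2 y) with hg
  have hgm : Measurable g := by
    have h0 : Measurable fun x : TailSpace k => ‖x‖⁻¹ • x := by fun_prop
    have h1 : Measurable ((Metric.ball (0 : TailSpace k) 1).indicator fun x => G (‖x‖⁻¹ • x)) :=
      Measurable.indicator (hGm.comp h0) Metric.isOpen_ball.measurableSet
    exact h1.comp (WithLp.measurable_toLp 2 _)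
  set H : ℂ × ({j : Fin n // k < j} → ℂ) → ℝ≥0∞ := fun p => F (tailVec k p.1 p.2) with hH
  have hHm : Measurable H := hF.comp (measurable_tailVec k)
  have h1 : ∫⁻ x : TailSpace k, (Metric.ball 0 1).indicator (fun x => G (‖x‖⁻¹ • x)) x
      = c * ∫⁻ y, g y := by
    have : ∫⁻ y, g y ∂((volume : Measure (TailSpace k)).map φ) = c * ∫⁻ y, g y := by
      rw [hmap, lintegral_smul_measure]; rfl
    rw [← this, lintegral_map hgm φ.continuous.measurable]
    rfl
  have h2 : ∫⁻ y, g y = ∫⁻ y : {j : Fin n // k < j} → ℂ, ∫⁻ z : ℂ,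
      g fun j => ((optionTailEquiv k).symm j).elim z y := by
    rw [← (measurePreserving_optionElim (optionTailEquiv k)).lintegral_comp hgm,
      Measure.volume_eq_prod, lintegral_prod]
    exact (hgm.comp (measurePreserving_optionElim (optionTailEquiv k)).measurable).aemeasurable
  have h3 : ∀ (y : {j : Fin n // k < j} → ℂ) (a b : ℝ),
      (g fun j => ((optionTailEquiv k).symm j).elim (⟨a, b⟩ : ℂ) y) = ballExtension H y b a := by
    intro y a b
    have hlt : √(a ^ 2 + b ^ 2 + sqNorm y) < 1 ↔ a ^ 2 + b ^ 2 + sqNorm y < 1 := by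
      rw [Real.sqrt_lt' one_pos, one_pow]
    have hball : (WithLp.toLp 2 fun j => ((optionTailEquiv k).symm j).elim (⟨a, b⟩ : ℂ) y :
        TailSpace k) ∈ Metric.ball (0 : TailSpace k) 1 ↔ a ^ 2 + b ^ 2 + sqNorm y < 1 := by
      rw [mem_ball_zero_iff, norm_elim, hlt]
    simp only [hg, ballExtension, hH]
    by_cases h : a ^ 2 + b ^ 2 + sqNorm y < 1
    · rw [indicator_of_mem (hball.2 h), if_pos h, norm_elim, hG]
      dsimp only
      rw [extendZero_elim]
    · rw [indicator_of_notMem (fun h' => h (hball.1 h')), if_neg h]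
  have h4 : ∀ y : {j : Fin n // k < j} → ℂ,
      ∫⁻ z : ℂ, (g fun j => ((optionTailEquiv k).symm j).elim z y)
        = ∫⁻ b : ℝ, ∫⁻ a : ℝ, ballExtension H y b a := by
    intro y
    rw [lintegral_complex_eq]
    · simp only [h3]
    · exact hgm.comp ((measurePreserving_optionElim (optionTailEquiv k)).measurable.comp
        (measurable_const.prodMk measurable_id))
  rw [uniformSphere, lintegral_smul_measure, hC₁ G hGm, h1, h2, lintegral_congr h4,
    lintegral_ballExtension H hHm, smul_eq_mul]
  simp only [← mul_assoc]
  rfl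

end UniformSphere

/-! ### Pairing reflections of consecutive indices up to conjugation. -/

section Slipping

open Matrix
open scoped ENNReal

variable {n : ℕ}

theorem sum_eq_add_sum_tail (k : Fin n) (g : Fin n → ℂ) (hg : ∀ j, j < k → g j = 0) :
    ∑ j, g j = g k + ∑ j : {j : Fin n // k < j}, g j := by
  have h1 : ∑ j, g j = ∑ j : {j : Fin n // k ≤ j}, g j := by
    rw [← Finset.sum_subtype (Finset.univ.filter fun j => k ≤ j) (by simp) g]
    exact (Finset.sum_filter_of_ne fun j _ hj => not_lt.1 fun h => hj (hg j h)).symm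
  rw [h1, ← Fintype.sum_equiv (optionTailEquiv k) (fun o => g (optionTailEquiv k o)) _
    (fun o => rfl), Fintype.sum_option]
  rfl

theorem star_tailVec_dotProduct (k : Fin n) (z : ℂ) (y : {j : Fin n // k < j} → ℂ) :
    star (tailVec k z y) ⬝ᵥ tailVec k z y = ((‖z‖ ^ 2 + sqNorm y : ℝ) : ℂ) := by
  rw [dotProduct, sum_eq_add_sum_tail k _ fun j hj => by
    rw [tailVec_of_gt _ _ hj, mul_zero], Pi.star_apply, tailVec_self]
  have : ∀ j : {j : Fin n // k < j}, star (tailVec k z y) j * tailVec k z y j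
      = ((‖y j‖ ^ 2 : ℝ) : ℂ) := by
    intro j
    rw [Pi.star_apply, tailVec_of_lt z y j.2, Complex.star_def, Complex.conj_mul']
    push_cast; rfl
  rw [Finset.sum_congr rfl fun j _ => this j, Complex.star_def, Complex.conj_mul', sqNorm]
  push_cast; rfl

theorem smul_tailVec (k : Fin n) (r : ℝ) (z : ℂ) (y : {j : Fin n // k < j} → ℂ) :
    r • tailVec k z y = tailVec k (r • z) (r • y) := by
  funext j
  rcases lt_trichotomy j k with h | h | h
  · simp [tailVec_of_gt _ _ h]
  · subst h; simp [tailVec_self]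
  · simp [tailVec_of_lt _ _ h]

theorem tailVec_sub_single (k : Fin n) (z : ℂ) (y : {j : Fin n // k < j} → ℂ) :
    tailVec k z y - Pi.single k 1 = tailVec k (z - 1) y := by
  funext j
  rcases lt_trichotomy j k with h | h | h
  · simp [tailVec_of_gt _ _ h, h.ne]
  · subst h; simp [tailVec_self]
  · simp [tailVec_of_lt _ _ h, h.ne']

/-- The phase of `1 - v_k` for the point `v` of the unit sphere with the parameters `β`, `η`. -/
noncomputable def spherePhase (β : ℝ) : ℂ := (1 - β * Complex.I) / (√(1 + β ^ 2) : ℝ)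

theorem sqrt_one_add_sq_pos (β : ℝ) : 0 < √(1 + β ^ 2) := Real.sqrt_pos.2 (by positivity)

theorem norm_one_sub_mul_I (β : ℝ) : ‖(1 - β * Complex.I : ℂ)‖ = √(1 + β ^ 2) := by
  rw [Complex.norm_def, Complex.normSq_apply]
  simp [sq]

theorem norm_spherePhase (β : ℝ) : ‖spherePhase β‖ = 1 := by
  rw [spherePhase, norm_div, norm_one_sub_mul_I, Complex.norm_real,
    Real.norm_of_nonneg (sqrt_one_add_sq_pos β).le, div_self (sqrt_one_add_sq_pos β).ne']

theorem spherePhase_mul_star (β : ℝ) : spherePhase β * star (spherePhase β) = 1 := by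
  rw [Complex.star_def, Complex.mul_conj', norm_spherePhase]; simp

theorem sphereRatio_pos (β : ℝ) {q : ℝ} (hq : 0 ≤ q) : 0 < sphereRatio β q :=
  div_pos (sqrt_one_add_sq_pos β) (sphereScale_pos β hq)

theorem one_sub_sphereHead (β q : ℝ) : 1 - sphereHead β q = sphereRatio β q * spherePhase β := by
  have : ((√(1 + β ^ 2) : ℝ) : ℂ) ≠ 0 := by exact_mod_cast (sqrt_one_add_sq_pos β).ne'
  rw [sphereHead, sphereRatio, spherePhase]
  push_cast
  field_simp
  ring

theorem star_tailPoint_dotProduct (k : Fin n) (β : ℝ) (η : {j : Fin n // k < j} → ℂ) :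
    star (tailPoint k β η) ⬝ᵥ tailPoint k β η = 1 := by
  have hM := sphereScale_pos β (sqNorm_nonneg η)
  have hs : √(1 + β ^ 2) ^ 2 = 1 + β ^ 2 := Real.sq_sqrt (by positivity)
  rw [tailPoint, star_tailVec_dotProduct, sqNorm_smul]
  have h1 : ‖sphereHead β (sqNorm η)‖ ^ 2
      = ((sphereScale β (sqNorm η) - 1) ^ 2 + β ^ 2) / sphereScale β (sqNorm η) ^ 2 := by
    have : sphereHead β (sqNorm η)
        = (⟨sphereScale β (sqNorm η) - 1, β⟩ : ℂ) / (sphereScale β (sqNorm η) : ℝ) := by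
      have hc : ((sphereScale β (sqNorm η) : ℝ) : ℂ) ≠ 0 := by exact_mod_cast hM.ne'
      have he : (⟨sphereScale β (sqNorm η) - 1, β⟩ : ℂ)
          = ((sphereScale β (sqNorm η) : ℝ) - 1) + β * Complex.I := by
        apply Complex.ext <;> simp
      rw [sphereHead, he]
      field_simp
      ring
    rw [this, norm_div, div_pow, Complex.norm_real, Real.norm_of_nonneg hM.le, Complex.sq_norm,
      Complex.normSq_apply]
    simp [sq]
  have h2 : (1 + β ^ 2) * (1 + sqNorm η) = 2 * sphereScale β (sqNorm η) := by
    rw [sphereScale]; ring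
  rw [h1, sphereRatio, div_pow, hs]
  norm_cast
  rw [div_mul_eq_mul_div, ← add_div, div_eq_one_iff_eq (by positivity)]
  linear_combination h2

/-- The rescaled difference of a point of the unit sphere and the basis vector `e_k`. -/
noncomputable def reflectionVec (k : Fin n) (β : ℝ) (η : {j : Fin n // k < j} → ℂ) : Fin n → ℂ :=
  √(sphereRatio β (sqNorm η)) • tailVec k (-spherePhase β) η

/-- With `ρ = |1 - v_k|` and `ω` the phase, `v - e_k = ρ (-ω, η)` and `(1 - conj v_k)⁻¹ = ρ⁻¹ ω`.
The powers of `ρ` combine to a single `ρ`, shared equally by the two vectors. The scalar that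
remains depends on `β` alone, so reflections with equal `β` can be compared through their vectors.
-/
theorem unitaryReflection_tailPoint (k : Fin n) (β : ℝ) (η : {j : Fin n // k < j} → ℂ) :
    (unitaryReflection k (tailPoint k β η) : Matrix (Fin n) (Fin n) ℂ)
      = 1 - spherePhase β • vecMulVec (reflectionVec k β η) (star (reflectionVec k β η)) := by
  have hρ := sphereRatio_pos β (sqNorm_nonneg η)
  have hρc : ((sphereRatio β (sqNorm η) : ℝ) : ℂ) ≠ 0 := by exact_mod_cast hρ.ne'
  have hv : tailPoint k β η - Pi.single k 1
      = sphereRatio β (sqNorm η) • tailVec k (-spherePhase β) η := by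
    rw [tailPoint, tailVec_sub_single, smul_tailVec, ← neg_sub, one_sub_sphereHead]
    simp
  have hk : (1 - star (tailPoint k β η k))⁻¹
      = (sphereRatio β (sqNorm η) : ℂ)⁻¹ * spherePhase β := by
    rw [tailPoint, tailVec_self, ← star_one ℂ, ← star_sub, one_sub_sphereHead, star_mul',
      mul_inv, inv_eq_of_mul_eq_one_left
      (spherePhase_mul_star β), Complex.star_def, Complex.conj_ofReal]
  have hsq : (√(sphereRatio β (sqNorm η)) : ℂ) * √(sphereRatio β (sqNorm η))
      = sphereRatio β (sqNorm η) := by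
    exact_mod_cast Real.mul_self_sqrt hρ.le
  rw [coe_unitaryReflection k (star_tailPoint_dotProduct k β η), reflectionMatrix, hv, hk,
    reflectionVec]
  congr 1
  ext i j
  simp only [Matrix.smul_apply, vecMulVec_apply, Pi.smul_apply, Pi.star_apply, star_smul,
    smul_eq_mul, Complex.real_smul, star_trivial]
  linear_combination (-spherePhase β * tailVec k (-spherePhase β) η i *
    star (tailVec k (-spherePhase β) η j)) * hsq +
    (spherePhase β * tailVec k (-spherePhase β) η i * star (tailVec k (-spherePhase β) η j) *
    (sphereRatio β (sqNorm η) : ℂ)) * (inv_mul_cancel₀ hρc)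

/-- The parameters of a point of the sphere of the coordinates from `k` on, built from parameters
of a point of the sphere of the coordinates behind `k` and an extra coordinate. -/
noncomputable def slipParam {k k' : Fin n} (hk : (k' : ℕ) = k + 1) (z : ℂ)
    (y : {j : Fin n // k' < j} → ℂ) : {j : Fin n // k < j} → ℂ :=
  fun j => ((optionShiftEquiv hk).symm j).elim z (√(1 + ‖z‖ ^ 2) • y)

theorem sqNorm_elim {k k' : Fin n} (hk : (k' : ℕ) = k + 1) (z : ℂ)
    (y : {j : Fin n // k' < j} → ℂ) :
    sqNorm (fun j => ((optionShiftEquiv hk).symm j).elim z y) = ‖z‖ ^ 2 + sqNorm y := by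
  rw [sqNorm, ← Fintype.sum_equiv (optionShiftEquiv hk) (fun o => ‖o.elim z y‖ ^ 2) _
    (fun o => by simp), Fintype.sum_option]
  rfl

/-- This product formula is the reason for the factor `√(1 + |z|²)` in `slipParam`: `z` then enters
the scale and the ratio only through the factor `1 + |z|²`. -/
theorem one_add_sqNorm_slipParam {k k' : Fin n} (hk : (k' : ℕ) = k + 1) (z : ℂ)
    (y : {j : Fin n // k' < j} → ℂ) :
    1 + sqNorm (slipParam hk z y) = (1 + ‖z‖ ^ 2) * (1 + sqNorm y) := by
  have h : sqNorm (slipParam hk z y) = ‖z‖ ^ 2 + sqNorm (√(1 + ‖z‖ ^ 2) • y) := sqNorm_elim hk z _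
  rw [h, sqNorm_smul, Real.sq_sqrt (by positivity)]
  ring

theorem sphereScale_slipParam {k k' : Fin n} (hk : (k' : ℕ) = k + 1) (β : ℝ) (z : ℂ)
    (y : {j : Fin n // k' < j} → ℂ) :
    sphereScale β (sqNorm (slipParam hk z y)) = (1 + ‖z‖ ^ 2) * sphereScale β (sqNorm y) := by
  rw [sphereScale, one_add_sqNorm_slipParam, sphereScale]
  ring

theorem sphereRatio_slipParam {k k' : Fin n} (hk : (k' : ℕ) = k + 1) (β : ℝ) (z : ℂ)
    (y : {j : Fin n // k' < j} → ℂ) :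
    sphereRatio β (sqNorm y) = (1 + ‖z‖ ^ 2) * sphereRatio β (sqNorm (slipParam hk z y)) := by
  have h := sphereScale_pos β (sqNorm_nonneg y)
  rw [sphereRatio, sphereRatio, sphereScale_slipParam]
  field_simp

theorem slipParam_apply_of_lt {k k' : Fin n} (hk : (k' : ℕ) = k + 1) (z : ℂ)
    (y : {j : Fin n // k' < j} → ℂ) {j : Fin n} (h : k' < j) (h' : k < j) :
    slipParam hk z y ⟨j, h'⟩ = (√(1 + ‖z‖ ^ 2) • y) ⟨j, h⟩ := by
  have : (⟨j, h'⟩ : {j : Fin n // k < j}) = optionShiftEquiv hk (some ⟨j, h⟩) := rfl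
  rw [slipParam, this, Equiv.symm_apply_apply]
  rfl

/-- The vectors are `√ρ (-ω, z, √(1 + |z|²) y)` and `√ρ' (0, -ω, y)` in the coordinates from `k` on.
Since `ρ' = (1 + |z|²) ρ`, they agree from coordinate `k + 2` on and have the same norm. -/
theorem exists_conj_unitaryReflection_slipParam {k k' : Fin n} (hk : (k' : ℕ) = k + 1)
    {B : unitaryGroup (Fin n) ℂ} (hB : B ∈ headFixing n (k + 2)) (β : ℝ) (z : ℂ)
    (y : {j : Fin n // k' < j} → ℂ) :
    ∃ g ∈ headFixing n k, unitaryReflection k' (tailPoint k' β y) * B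
      = g * (unitaryReflection k (tailPoint k β (slipParam hk z y)) * B) * g⁻¹ := by
  have hρ := sphereRatio_pos β (sqNorm_nonneg (slipParam hk z y))
  have hρ' := sphereRatio_pos β (sqNorm_nonneg y)
  have hrat := sphereRatio_slipParam hk β z y
  refine exists_conj_of_one_sub_smul_vecMulVec hB (unitaryReflection_tailPoint k β _)
    (unitaryReflection_tailPoint k' β y) ?_ ?_ ?_
  · rw [reflectionVec, reflectionVec, smul_tailVec, smul_tailVec, star_tailVec_dotProduct,
      star_tailVec_dotProduct, sqNorm_smul, sqNorm_smul, norm_smul, norm_smul, norm_neg,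
      norm_spherePhase, mul_one, mul_one, Real.norm_of_nonneg (Real.sqrt_nonneg _),
      Real.norm_of_nonneg (Real.sqrt_nonneg _), Real.sq_sqrt hρ.le, Real.sq_sqrt hρ'.le]
    norm_cast
    rw [hrat]
    linear_combination sphereRatio β (sqNorm (slipParam hk z y)) * one_add_sqNorm_slipParam hk z y
  · intro j hj
    have h1 : j < k := Fin.lt_def.2 hj
    have h2 : j < k' := Fin.lt_def.2 (by omega)
    rw [reflectionVec, reflectionVec, Pi.smul_apply, Pi.smul_apply, tailVec_of_gt _ _ h1,
      tailVec_of_gt _ _ h2, smul_zero, smul_zero]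
  · intro j hj
    have h1 : k < j := Fin.lt_def.2 (by omega)
    have h2 : k' < j := Fin.lt_def.2 (by omega)
    rw [reflectionVec, reflectionVec, Pi.smul_apply, Pi.smul_apply, tailVec_of_lt _ _ h1,
      tailVec_of_lt _ _ h2, slipParam_apply_of_lt hk z y h2 h1, hrat,
      Real.sqrt_mul (by positivity), Pi.smul_apply, smul_smul, mul_comm]

end Slipping

/-! ### Slipping for weighted integrals over spheres. -/

section SlippingIntegral

open Matrix
open scoped ENNReal

variable {n : ℕ}

/-- The sampling weight as a function of the entry `r_kk`. -/
noncomputable def entryWeight (δ z : ℂ) : ℝ := ((1 - z) ^ (star δ) * (1 - star z) ^ δ).re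

theorem measurable_entryWeight (δ : ℂ) : Measurable (entryWeight δ) := by
  have hst : Measurable (star : ℂ → ℂ) := Complex.continuous_conj.measurable
  exact Complex.measurable_re.comp (((measurable_const.sub measurable_id).pow_const _).mul
    ((measurable_const.sub hst).pow_const _))

/-- The two powers are conjugate, because the principal branch commutes with conjugation off the
negative axis. The formula separates modulus and phase: a slip rescales the modulus and keeps the
phase, and passing to `δ + 1` affects only the exponent of the modulus. -/
theorem entryWeight_eq (δ : ℂ) {z : ℂ} (hz : 0 < (1 - z).re) :
    entryWeight δ z = (‖1 - z‖ ^ δ.re * Real.exp ((1 - z).arg * δ.im)) ^ 2 := by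
  have h0 : 1 - z ≠ 0 := fun h => by rw [h] at hz; simp at hz
  have harg : (1 - z).arg ≠ Real.pi := by
    rw [Ne, Complex.arg_eq_pi_iff]; intro h; linarith [h.1]
  have hzs : 1 - star z = star (1 - z) := by simp
  have h1 : (1 - z) ^ (star δ) * (1 - star z) ^ δ = ((‖(1 - z) ^ star δ‖ ^ 2 : ℝ) : ℂ) := by
    have := Complex.conj_cpow (1 - z) δ harg
    simp only [← Complex.star_def] at this
    rw [hzs, this, Complex.star_def, Complex.mul_conj']; simp
  rw [entryWeight, h1, Complex.ofReal_re, Complex.norm_cpow_of_ne_zero h0]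
  congr 1
  simp [Real.exp_neg]

theorem entryWeight_sphereHead (δ : ℂ) (β : ℝ) {q : ℝ} (hq : 0 ≤ q) :
    entryWeight δ (sphereHead β q)
      = (sphereRatio β q ^ δ.re * Real.exp ((spherePhase β).arg * δ.im)) ^ 2 := by
  have hρ := sphereRatio_pos β hq
  have hre : 0 < (spherePhase β).re := by
    have hs := sqrt_one_add_sq_pos β
    rw [spherePhase, Complex.div_ofReal_re]
    simp only [Complex.sub_re, Complex.one_re, Complex.mul_re, Complex.ofReal_re, Complex.I_re,
      Complex.ofReal_im, Complex.I_im]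
    simp [hs]
  rw [entryWeight_eq, one_sub_sphereHead, Complex.arg_real_mul _ hρ, norm_mul, norm_spherePhase,
    mul_one, Complex.norm_real, Real.norm_of_nonneg hρ.le]
  rw [one_sub_sphereHead, Complex.re_ofReal_mul]
  exact mul_pos hρ hre

theorem entryWeight_sphereHead_pos (δ : ℂ) (β : ℝ) {q : ℝ} (hq : 0 ≤ q) :
    0 < entryWeight δ (sphereHead β q) := by
  have hρ := sphereRatio_pos β hq
  rw [entryWeight_sphereHead δ β hq]
  positivity

/-- The integral of `f` over the sphere of the coordinates from `k` on, weighted by the sampling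
weight, in the coordinates `β`, `η`. -/
noncomputable def weightedSphereIntegral (k : Fin n) (δ : ℂ) (f : (Fin n → ℂ) → ℝ≥0∞) : ℝ≥0∞ :=
  ∫⁻ β : ℝ, ∫⁻ η : {j : Fin n // k < j} → ℂ,
    ENNReal.ofReal (sphereDensity (Fintype.card {j : Fin n // k < j}) β (sqNorm η)) *
      (ENNReal.ofReal (entryWeight δ (tailPoint k β η k)) * f (tailPoint k β η))

theorem measurable_tailPoint (k : Fin n) :
    Measurable fun p : ℝ × ({j : Fin n // k < j} → ℂ) => tailPoint k p.1 p.2 := by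
  have hq : Measurable fun p : ℝ × ({j : Fin n // k < j} → ℂ) => (p.1, sqNorm p.2) :=
    measurable_fst.prodMk (measurable_sqNorm.comp measurable_snd)
  exact (measurable_tailVec k).comp ((measurable_sphereHead.comp hq).prodMk
    ((measurable_sphereRatio.comp hq).smul measurable_snd))

theorem measurable_weightedSphereIntegrand (k : Fin n) (δ : ℂ) {f : (Fin n → ℂ) → ℝ≥0∞}
    (hf : Measurable f) : Measurable fun p : ℝ × ({j : Fin n // k < j} → ℂ) =>
      ENNReal.ofReal (sphereDensity (Fintype.card {j : Fin n // k < j}) p.1 (sqNorm p.2)) *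
      (ENNReal.ofReal (entryWeight δ (tailPoint k p.1 p.2 k)) * f (tailPoint k p.1 p.2)) := by
  have hq : Measurable fun p : ℝ × ({j : Fin n // k < j} → ℂ) => (p.1, sqNorm p.2) :=
    measurable_fst.prodMk (measurable_sqNorm.comp measurable_snd)
  exact ((measurable_sphereDensity _).comp hq).ennreal_ofReal.mul
    (((measurable_entryWeight δ).comp ((measurable_pi_apply k).comp
      (measurable_tailPoint k))).ennreal_ofReal.mul (hf.comp (measurable_tailPoint k)))

/-- The factor that comes from the coordinate that is integrated out. -/
noncomputable def slipFactor (N : ℕ) (δ : ℂ) (z : ℂ) : ℝ :=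
  (1 + ‖z‖ ^ 2) ^ N * ((1 + ‖z‖ ^ 2) ^ (2 * N + 3))⁻¹ * (((1 + ‖z‖ ^ 2) ^ δ.re)⁻¹) ^ 2

theorem slipFactor_nonneg (N : ℕ) (δ z : ℂ) : 0 ≤ slipFactor N δ z := by
  unfold slipFactor; positivity

theorem card_tail_eq {k k' : Fin n} (hk : (k' : ℕ) = k + 1) :
    Fintype.card {j : Fin n // k < j} = Fintype.card {j : Fin n // k' < j} + 1 := by
  rw [← Fintype.card_congr (optionShiftEquiv hk), Fintype.card_option]

/-- This is where the exponent rises by one. Apart from powers of `1 + |z|²`, the densities in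
dimensions `N + 1` and `N` differ by `(1 + β²) / M² = ρ²`, both `M` and `ρ` taken at `y`, and this
is the weight of exponent `1`. The left factor `√(1 + |z|²)^(2N)` is the Jacobian of the rescaling
of `y` in `slipParam`. -/
theorem sphereDensity_slipParam {k k' : Fin n} (hk : (k' : ℕ) = k + 1) (N : ℕ) (δ : ℂ) (β : ℝ)
    (z : ℂ) (y : {j : Fin n // k' < j} → ℂ) :
    √(1 + ‖z‖ ^ 2) ^ (2 * N) * (sphereDensity (N + 1) β (sqNorm (slipParam hk z y)) *
        entryWeight δ (sphereHead β (sqNorm (slipParam hk z y))))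
      = slipFactor N δ z * (sphereDensity N β (sqNorm y) *
        entryWeight (δ + 1) (sphereHead β (sqNorm y))) := by
  have hρ' := sphereRatio_pos β (sqNorm_nonneg y)
  have hM' := sphereScale_pos β (sqNorm_nonneg y)
  have hc : 0 < 1 + ‖z‖ ^ 2 := by positivity
  have hs : √(1 + β ^ 2) ^ 2 = 1 + β ^ 2 := Real.sq_sqrt (by positivity)
  have hρ : sphereRatio β (sqNorm (slipParam hk z y))
      = sphereRatio β (sqNorm y) / (1 + ‖z‖ ^ 2) := by
    rw [sphereRatio_slipParam hk]; field_simp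
  have hsq : sphereRatio β (sqNorm y) ^ 2 = (1 + β ^ 2) / sphereScale β (sqNorm y) ^ 2 := by
    rw [sphereRatio, div_pow, hs]
  rw [entryWeight_sphereHead _ _ (sqNorm_nonneg _), entryWeight_sphereHead _ _ (sqNorm_nonneg _),
    hρ, Real.div_rpow hρ'.le hc.le, Complex.add_re, Complex.one_re, Real.rpow_add_one hρ'.ne',
    Complex.add_im, Complex.one_im, add_zero, sphereDensity, sphereDensity, sphereScale_slipParam,
    pow_mul, Real.sq_sqrt hc.le, slipFactor]
  simp only [mul_pow (_ * _) (Real.exp _), mul_pow _ (sphereRatio β (sqNorm y)), hsq]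
  generalize sphereRatio β (sqNorm y) ^ δ.re = A
  generalize Real.exp _ = E
  have hC : (1 + ‖z‖ ^ 2) ^ δ.re ≠ 0 := (Real.rpow_pos_of_pos hc _).ne'
  generalize (1 + ‖z‖ ^ 2) ^ δ.re = C at hC
  generalize 1 + ‖z‖ ^ 2 = c at hc
  generalize sphereScale β (sqNorm y) = M at hM'
  generalize 1 + β ^ 2 = b
  have e1 : 2 * (N + 1) + 1 = 2 * N + 3 := by ring
  rw [e1, mul_pow c M, pow_succ b N, show M ^ (2 * N + 3) = M ^ (2 * N + 1) * M ^ 2 by ring]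
  field_simp

theorem weightedSphereIntegral_slip {k k' : Fin n} (hk : (k' : ℕ) = k + 1) (δ : ℂ)
    {f f' : (Fin n → ℂ) → ℝ≥0∞} (hf : Measurable f) (hf' : Measurable f')
    (hff' : ∀ β z y, f (tailPoint k β (slipParam hk z y)) = f' (tailPoint k' β y)) :
    weightedSphereIntegral k δ f
      = (∫⁻ z : ℂ, ENNReal.ofReal (slipFactor (Fintype.card {j : Fin n // k' < j}) δ z)) *
        weightedSphereIntegral k' (δ + 1) f' := by
  set N := Fintype.card {j : Fin n // k' < j} with hN
  obtain ⟨Φ, hΦ⟩ : ∃ Φ : ℝ → ({j : Fin n // k < j} → ℂ) → ℝ≥0∞, ∀ β η, Φ β η =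
    ENNReal.ofReal (sphereDensity (Fintype.card {j : Fin n // k < j}) β (sqNorm η)) *
      (ENNReal.ofReal (entryWeight δ (tailPoint k β η k)) * f (tailPoint k β η)) :=
    ⟨_, fun _ _ => rfl⟩
  obtain ⟨Φ', hΦ'⟩ : ∃ Φ' : ℝ → ({j : Fin n // k' < j} → ℂ) → ℝ≥0∞, ∀ β η, Φ' β η =
    ENNReal.ofReal (sphereDensity (Fintype.card {j : Fin n // k' < j}) β (sqNorm η)) *
      (ENNReal.ofReal (entryWeight (δ + 1) (tailPoint k' β η k')) * f' (tailPoint k' β η)) :=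
    ⟨_, fun _ _ => rfl⟩
  have hΦm : Measurable fun p : ℝ × ({j : Fin n // k < j} → ℂ) => Φ p.1 p.2 := by
    simp only [hΦ]; exact measurable_weightedSphereIntegrand k δ hf
  have hΦm' : Measurable fun p : ℝ × ({j : Fin n // k' < j} → ℂ) => Φ' p.1 p.2 := by
    simp only [hΦ']; exact measurable_weightedSphereIntegrand k' (δ + 1) hf'
  have hpt : ∀ β z y, ENNReal.ofReal (√(1 + ‖z‖ ^ 2) ^ (2 * N)) * Φ β (slipParam hk z y)
      = ENNReal.ofReal (slipFactor N δ z) * Φ' β y := by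
    intro β z y
    have hd := (sphereDensity_pos (N + 1) β (sqNorm_nonneg (slipParam hk z y))).le
    have hd' := (sphereDensity_pos N β (sqNorm_nonneg y)).le
    rw [hΦ, hΦ', hff', card_tail_eq hk, ← hN, ← mul_assoc (ENNReal.ofReal (sphereDensity _ _ _)),
      ← mul_assoc (ENNReal.ofReal (sphereDensity _ _ _)), ← ENNReal.ofReal_mul hd,
      ← ENNReal.ofReal_mul hd', ← mul_assoc, ← mul_assoc, ← ENNReal.ofReal_mul (by positivity),
      ← ENNReal.ofReal_mul (slipFactor_nonneg N δ z), tailPoint, tailPoint, tailVec_self,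
      tailVec_self, sphereDensity_slipParam]
  have hL : Measurable fun z : ℂ => ENNReal.ofReal (slipFactor N δ z) := by
    unfold slipFactor; fun_prop
  have hη : ∀ β, ∫⁻ η, Φ β η
      = (∫⁻ z : ℂ, ENNReal.ofReal (slipFactor N δ z)) * ∫⁻ y, Φ' β y := by
    intro β
    have hm : Measurable (Φ β) :=
      hΦm.comp (by fun_prop : Measurable fun η : {j : Fin n // k < j} → ℂ => (β, η))
    have hm' : Measurable (Φ' β) :=
      hΦm'.comp (by fun_prop : Measurable fun η : {j : Fin n // k' < j} → ℂ => (β, η))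
    have he := measurePreserving_optionElim (optionShiftEquiv hk)
    rw [← he.lintegral_comp hm, Measure.volume_eq_prod, lintegral_prod_symm'
      (fun p : ({j : Fin n // k' < j} → ℂ) × ℂ =>
        Φ β fun j => ((optionShiftEquiv hk).symm j).elim p.2 p.1) (hm.comp he.measurable),
      ← lintegral_mul_const _ hL]
    refine lintegral_congr fun z => ?_
    have hmz : Measurable fun y : {j : Fin n // k' < j} → ℂ =>
        Φ β fun j => ((optionShiftEquiv hk).symm j).elim z y :=
      hm.comp (he.measurable.comp (measurable_id.prodMk measurable_const))
    have hcz : 0 < √(1 + ‖z‖ ^ 2) := Real.sqrt_pos.2 (by positivity)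
    -- For fixed `z`, rescaling the last coordinates by `√(1 + |z|²)` turns `η` into `slipParam hk z
    -- y`.
    rw [lintegral_pi_eq_lintegral_comp_smul hmz hcz, ← lintegral_const_mul,
      ← lintegral_const_mul _ hm']
    · exact lintegral_congr fun y => hpt β z y
    · exact hmz.comp (measurable_const_smul _)
  rw [weightedSphereIntegral, weightedSphereIntegral]
  simp only [← hΦ, ← hΦ']
  rw [lintegral_congr hη, lintegral_const_mul _ (Measurable.lintegral_prod_right' hΦm')]

end SlippingIntegral

/-! ### The slip of a single reflection in front of a fixed matrix. -/

section ReflectionLaws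

open Matrix
open scoped ENNReal

variable {n : ℕ}

theorem lintegral_nu (k : Fin n) {g : unitaryGroup (Fin n) ℂ → ℝ≥0∞} (hg : Measurable g) :
    ∫⁻ r, g r ∂nu k = ∫⁻ x : Metric.sphere (0 : TailSpace k) 1,
      g (unitaryReflection k (extendZero k x)) ∂uniformSphere k := by
  rw [nu, lintegral_map hg (measurable_reflection k)]
  simp only [reflection_eq_unitaryReflection]

theorem measurable_expWeight (k : Fin n) (δ : ℂ) :
    Measurable (expWeight k δ : unitaryGroup (Fin n) ℂ → ℝ) :=
  (measurable_entryWeight δ).comp (measurable_unitary_entry k k)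

theorem exists_setLIntegral_nu (k : Fin n) (δ : ℂ) : ∃ C : ℝ≥0∞,
    ∀ S : Set (unitaryGroup (Fin n) ℂ), MeasurableSet S →
      ∫⁻ r in S, ENNReal.ofReal (expWeight k δ r) ∂nu k
        = C * weightedSphereIntegral k δ fun v => S.indicator 1 (unitaryReflection k v) := by
  obtain ⟨C, hC⟩ := exists_lintegral_uniformSphere k
  refine ⟨C, fun S hS => ?_⟩
  have hw := (measurable_expWeight k δ).ennreal_ofReal
  rw [← lintegral_indicator hS, lintegral_nu k (hw.indicator hS),
    hC (fun v => S.indicator (fun r => ENNReal.ofReal (expWeight k δ r)) (unitaryReflection k v))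
      ((hw.indicator hS).comp (measurable_unitaryReflection k)), weightedSphereIntegral]
  congr 1
  refine lintegral_congr fun β => lintegral_congr fun η => ?_
  congr 1
  have : expWeight k δ (unitaryReflection k (tailPoint k β η))
      = entryWeight δ (tailPoint k β η k) := by
    rw [expWeight, coe_unitaryReflection k (star_tailPoint_dotProduct k β η),
      reflectionMatrix_apply_self, entryWeight]
  by_cases h : unitaryReflection k (tailPoint k β η) ∈ S
  · rw [Set.indicator_of_mem h, Set.indicator_of_mem h, this, Pi.one_apply, mul_one]
  · rw [Set.indicator_of_notMem h, Set.indicator_of_notMem h, mul_zero]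

theorem sampling_apply {X : Type*} [MeasurableSpace X] (μ : Measure X) (h : X → ℝ) {S : Set X}
    (hS : MeasurableSet S) : sampling μ h S
      = (∫⁻ x, ENNReal.ofReal (h x) ∂μ)⁻¹ * ∫⁻ x in S, ENNReal.ofReal (h x) ∂μ := by
  rw [sampling, Measure.smul_apply, withDensity_apply _ hS, smul_eq_mul]

/-- Total weight `0` or `∞` would give the sampled measure total mass `0`, by the conventions `∞ * 0
= 0` and `∞⁻¹ = 0`. -/
theorem lintegral_ne_zero_and_ne_top_of_sampling {X : Type*} [MeasurableSpace X] (μ : Measure X)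
    (h : X → ℝ) (_ : IsProbabilityMeasure (sampling μ h)) :
    ∫⁻ x, ENNReal.ofReal (h x) ∂μ ≠ 0 ∧ ∫⁻ x, ENNReal.ofReal (h x) ∂μ ≠ ∞ := by
  have h1 : sampling μ h Set.univ = 1 := measure_univ
  rw [sampling_apply μ h MeasurableSet.univ, Measure.restrict_univ] at h1
  constructor
  · intro h0; rw [h0, mul_zero] at h1; exact zero_ne_one h1
  · intro h0; rw [h0, ENNReal.inv_top, zero_mul] at h1; exact zero_ne_one h1

/-- A set of unitary matrices that is invariant under conjugation by the elements of `G`. -/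
def ConjInvariant (G : Subgroup (unitaryGroup (Fin n) ℂ)) (s : Set (unitaryGroup (Fin n) ℂ)) :
    Prop :=
  ∀ g ∈ G, ∀ u, g * u * g⁻¹ ∈ s ↔ u ∈ s

/-- Right multiplication by a matrix that fixes the first `k + 2` basis vectors does not
distinguish the laws of the reflections with the indices `k` and `k + 1` up to conjugation. -/
theorem nuDelta_preimage_mul_right_eq {k k' : Fin n} (hk : (k' : ℕ) = k + 1) (δ : ℂ)
    [IsProbabilityMeasure (nuDelta k δ)] [IsProbabilityMeasure (nuDelta k' (δ + 1))]
    {B : unitaryGroup (Fin n) ℂ} (hB : B ∈ headFixing n (k + 2))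
    {s : Set (unitaryGroup (Fin n) ℂ)} (hs : MeasurableSet s)
    (hinv : ConjInvariant (headFixing n k) s) :
    nuDelta k δ {r | r * B ∈ s} = nuDelta k' (δ + 1) {r | r * B ∈ s} := by
  obtain ⟨C, hC⟩ := exists_setLIntegral_nu k δ
  obtain ⟨C', hC'⟩ := exists_setLIntegral_nu k' (δ + 1)
  set L := ∫⁻ z : ℂ, ENNReal.ofReal (slipFactor (Fintype.card {j : Fin n // k' < j}) δ z)
  have key : ∀ t : Set (unitaryGroup (Fin n) ℂ), MeasurableSet t →
      ConjInvariant (headFixing n k) t → MeasurableSet {r | r * B ∈ t} ∧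
      weightedSphereIntegral k δ (fun v => {r | r * B ∈ t}.indicator 1 (unitaryReflection k v))
        = L * weightedSphereIntegral k' (δ + 1)
          fun v => {r | r * B ∈ t}.indicator 1 (unitaryReflection k' v) := by
    intro t ht hti
    have hm : MeasurableSet {r | r * B ∈ t} := measurable_mul_const B ht
    have hind : Measurable ({r | r * B ∈ t}.indicator (1 : unitaryGroup (Fin n) ℂ → ℝ≥0∞)) :=
      measurable_one.indicator hm
    refine ⟨hm, weightedSphereIntegral_slip hk δ (hind.comp (measurable_unitaryReflection k))
      (hind.comp (measurable_unitaryReflection k')) fun β z y => ?_⟩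
    obtain ⟨g, hg, hgB⟩ := exists_conj_unitaryReflection_slipParam hk hB β z y
    have hiff : unitaryReflection k (tailPoint k β (slipParam hk z y)) ∈ {r | r * B ∈ t}
        ↔ unitaryReflection k' (tailPoint k' β y) ∈ {r | r * B ∈ t} := by
      rw [Set.mem_ofPred_eq, Set.mem_ofPred_eq, hgB, hti g hg]
    by_cases h : unitaryReflection k' (tailPoint k' β y) ∈ {r | r * B ∈ t}
    · rw [Set.indicator_of_mem h, Set.indicator_of_mem (hiff.2 h)]; rfl
    · rw [Set.indicator_of_notMem h, Set.indicator_of_notMem (fun h' => h (hiff.1 h'))]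
  obtain ⟨hm, hs'⟩ := key s hs hinv
  -- The case of the whole group compares the normalizing integrals with the same constants.
  obtain ⟨hmu, hu'⟩ := key Set.univ MeasurableSet.univ fun _ _ _ => by simp
  have hZ : ∫⁻ r, ENNReal.ofReal (expWeight k δ r) ∂nu k
      = ∫⁻ r in {r | r * B ∈ Set.univ}, ENNReal.ofReal (expWeight k δ r) ∂nu k := by simp
  have hZ' : ∫⁻ r, ENNReal.ofReal (expWeight k' (δ + 1) r) ∂nu k'
      = ∫⁻ r in {r | r * B ∈ Set.univ}, ENNReal.ofReal (expWeight k' (δ + 1) r) ∂nu k' := by simp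
  obtain ⟨h0, htop⟩ := lintegral_ne_zero_and_ne_top_of_sampling (nu k) (expWeight k δ)
    ‹IsProbabilityMeasure (nuDelta k δ)›
  obtain ⟨h0', htop'⟩ := lintegral_ne_zero_and_ne_top_of_sampling (nu k') (expWeight k' (δ + 1))
    ‹IsProbabilityMeasure (nuDelta k' (δ + 1))›
  -- In this product form both sides carry the same factor `C * C' * L`, so none of these constants
  -- has to be nonzero or finite.
  have hcross : (∫⁻ r in {r | r * B ∈ s}, ENNReal.ofReal (expWeight k δ r) ∂nu k) *
        (∫⁻ r, ENNReal.ofReal (expWeight k' (δ + 1) r) ∂nu k')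
      = (∫⁻ r, ENNReal.ofReal (expWeight k δ r) ∂nu k) *
        (∫⁻ r in {r | r * B ∈ s}, ENNReal.ofReal (expWeight k' (δ + 1) r) ∂nu k') := by
    rw [hZ, hZ', hC _ hm, hC _ hmu, hC' _ hm, hC' _ hmu, hs', hu']
    ring
  rw [nuDelta, nuDelta, sampling_apply _ _ hm, sampling_apply _ _ hm]
  generalize (∫⁻ r, ENNReal.ofReal (expWeight k δ r) ∂nu k) = a at h0 htop hcross
  generalize (∫⁻ r, ENNReal.ofReal (expWeight k' (δ + 1) r) ∂nu k') = a' at h0' htop' hcross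
  rw [← ENNReal.mul_left_inj h0' htop', mul_assoc, hcross, ← mul_assoc,
    ENNReal.inv_mul_cancel h0 htop, one_mul, mul_right_comm, ENNReal.inv_mul_cancel h0' htop',
    one_mul]

theorem measurableSet_headFixing (k : ℕ) :
    MeasurableSet {r : unitaryGroup (Fin n) ℂ | r ∈ headFixing n k} := by
  have : {r : unitaryGroup (Fin n) ℂ | r ∈ headFixing n k}
      = ⋂ (j : Fin n) (_ : (j : ℕ) < k) (i : Fin n),
        {r : unitaryGroup (Fin n) ℂ |
          (r : Matrix (Fin n) (Fin n) ℂ) i j = (Pi.single j 1 : Fin n → ℂ) i} := by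
    ext r
    simp only [Set.mem_iInter, Set.mem_ofPred_eq]
    refine ⟨fun h j hj i => apply_right_of_mem_headFixing h i hj, fun h j hj => ?_⟩
    funext i
    simpa using h j hj i
  rw [this]
  exact MeasurableSet.iInter fun j => MeasurableSet.iInter fun _ => MeasurableSet.iInter fun i =>
    measurableSet_eq_fun (measurable_unitary_entry i j) measurable_const

theorem ae_mem_headFixing_nuDelta (k : Fin n) (δ : ℂ) :
    ∀ᵐ r ∂nuDelta k δ, r ∈ headFixing n k := by
  have h1 : ∀ᵐ r ∂nu k, r ∈ headFixing n k :=
    (ae_map_iff (measurable_reflection k).aemeasurable (measurableSet_headFixing k)).2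
      (Filter.Eventually.of_forall fun x => reflection_mem_headFixing k x)
  exact Measure.ae_smul_measure ((withDensity_absolutelyContinuous _ _).ae_le h1) _

end ReflectionLaws

/-! ### Conjugation invariance of the laws of the reflections. -/

section ConjugationInvariance

open Matrix
open scoped ENNReal

variable {n : ℕ}

theorem norm_sq_eq_sum_extendZero (k : Fin n) (x : TailSpace k) :
    ‖x‖ ^ 2 = ∑ j, ‖extendZero k x j‖ ^ 2 := by
  rw [EuclideanSpace.norm_sq_eq]
  have h : ∀ j : {j : Fin n // k ≤ j}, ‖x j‖ ^ 2 = ‖extendZero k x j‖ ^ 2 := fun j => by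
    rw [extendZero, dif_pos j.2]
  rw [Finset.sum_congr rfl fun j _ => h j,
    ← Finset.sum_subtype (Finset.univ.filter fun j => k ≤ j) (by simp)
      fun j => ‖extendZero k x j‖ ^ 2]
  refine Finset.sum_filter_of_ne fun j _ hj => ?_
  by_contra hkj
  rw [extendZero, dif_neg hkj] at hj
  simp at hj

theorem star_dotProduct_self_eq_sum (v : Fin n → ℂ) :
    star v ⬝ᵥ v = ((∑ j, ‖v j‖ ^ 2 : ℝ) : ℂ) := by
  rw [dotProduct]
  push_cast
  exact Finset.sum_congr rfl fun j _ => Complex.conj_mul' (v j)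

/-- The linear map that a matrix induces on the coordinates from `k` on. -/
noncomputable def tailLinearMap (k : Fin n) (h : Matrix (Fin n) (Fin n) ℂ) :
    TailSpace k →ₗ[ℝ] TailSpace k where
  toFun x := WithLp.toLp 2 fun j => (h *ᵥ extendZero k x) j
  map_add' x y := by
    have : extendZero k (x + y) = extendZero k x + extendZero k y := by
      funext j
      by_cases hj : k ≤ j <;> simp [extendZero, hj]
    ext j
    simp [this, mulVec_add]
  map_smul' c x := by
    have : extendZero k (c • x) = c • extendZero k x := by
      funext j
      by_cases hj : k ≤ j <;> simp [extendZero, hj]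
    ext j
    simp [this, mulVec_smul]

theorem extendZero_tailLinearMap (k : Fin n) {h : unitaryGroup (Fin n) ℂ}
    (hh : h ∈ headFixing n k) (x : TailSpace k) :
    extendZero k (tailLinearMap k h x) = (h : Matrix (Fin n) (Fin n) ℂ) *ᵥ extendZero k x := by
  funext j
  by_cases hj : k ≤ j
  · rw [extendZero, dif_pos hj]; rfl
  · have hj' : (j : ℕ) < k := Fin.lt_def.1 (not_le.1 hj)
    rw [mulVec_apply_of_mem_headFixing hh _ hj', extendZero, extendZero, dif_neg hj, dif_neg hj]

/-- A unitary matrix that fixes the first basis vectors acts isometrically on the remaining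
coordinates. -/
noncomputable def tailIsometry (k : Fin n) {h : unitaryGroup (Fin n) ℂ}
    (hh : h ∈ headFixing n k) : TailSpace k ≃ₗᵢ[ℝ] TailSpace k :=
  LinearIsometry.toLinearIsometryEquiv
    { toLinearMap := tailLinearMap k h
      norm_map' := fun x => by
        have h1 := star_mulVec_dotProduct_mulVec h (extendZero k x) (extendZero k x)
        rw [← extendZero_tailLinearMap k hh, star_dotProduct_self_eq_sum,
          star_dotProduct_self_eq_sum, ← norm_sq_eq_sum_extendZero, ← norm_sq_eq_sum_extendZero]
          at h1
        have h2 : ‖tailLinearMap k (h : Matrix (Fin n) (Fin n) ℂ) x‖ ^ 2 = ‖x‖ ^ 2 := by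
          exact_mod_cast h1
        exact (pow_left_inj₀ (norm_nonneg _) (norm_nonneg _) two_ne_zero).1 h2 } rfl

theorem extendZero_tailIsometry (k : Fin n) {h : unitaryGroup (Fin n) ℂ}
    (hh : h ∈ headFixing n k) (x : TailSpace k) :
    extendZero k (tailIsometry k hh x) = (h : Matrix (Fin n) (Fin n) ℂ) *ᵥ extendZero k x :=
  extendZero_tailLinearMap k hh x

/-- Invariance is inherited from the volume on the unit ball, since a linear isometry commutes with
the radial projection to the sphere. -/
theorem lintegral_uniformSphere_comp_isometry (k : Fin n) (φ : TailSpace k ≃ₗᵢ[ℝ] TailSpace k)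
    {G : TailSpace k → ℝ≥0∞} (hG : Measurable G) :
    ∫⁻ x : Metric.sphere (0 : TailSpace k) 1, G (φ x) ∂uniformSphere k
      = ∫⁻ x : Metric.sphere (0 : TailSpace k) 1, G x ∂uniformSphere k := by
  obtain ⟨C, hC⟩ := lintegral_toSphere (volume : Measure (TailSpace k))
  have hGφ : Measurable fun x => G (φ x) := hG.comp φ.continuous.measurable
  have hm : Measurable
      ((Metric.ball (0 : TailSpace k) 1).indicator fun x => G (‖x‖⁻¹ • x)) := by
    have h0 : Measurable fun x : TailSpace k => ‖x‖⁻¹ • x := by fun_prop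
    exact Measurable.indicator (hG.comp h0) Metric.isOpen_ball.measurableSet
  rw [uniformSphere, lintegral_smul_measure, lintegral_smul_measure, hC _ hGφ, hC _ hG,
    ← φ.measurePreserving.lintegral_comp hm]
  congr 2
  refine lintegral_congr fun x => ?_
  by_cases hx : x ∈ Metric.ball (0 : TailSpace k) 1
  · have hx' : φ x ∈ Metric.ball (0 : TailSpace k) 1 := by simpa using hx
    rw [Set.indicator_of_mem hx, Set.indicator_of_mem hx', map_smul, φ.norm_map]
  · have hx' : φ x ∉ Metric.ball (0 : TailSpace k) 1 := by simpa using hx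
    rw [Set.indicator_of_notMem hx, Set.indicator_of_notMem hx']

/-- Because `h` fixes `e_k`, conjugating the reflection of `v` by `h` gives the reflection of `h v`,
and `h v` is again uniform on the sphere. -/
theorem lintegral_nu_conj (k : Fin n) {h : unitaryGroup (Fin n) ℂ} (hh : h ∈ headFixing n (k + 1))
    {g : unitaryGroup (Fin n) ℂ → ℝ≥0∞} (hg : Measurable g) :
    ∫⁻ r, g (h * r * h⁻¹) ∂nu k = ∫⁻ r, g r ∂nu k := by
  have hh' : h ∈ headFixing n k := headFixing_anti n (Nat.le_succ _) hh
  have hgc : Measurable fun r => g (h * r * h⁻¹) :=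
    hg.comp ((measurable_id.const_mul h).mul_const h⁻¹)
  have hG : Measurable fun x : TailSpace k => g (unitaryReflection k (extendZero k x)) :=
    hg.comp ((measurable_unitaryReflection k).comp (measurable_extendZero k))
  rw [lintegral_nu k hgc, lintegral_nu k hg,
    ← lintegral_uniformSphere_comp_isometry k (tailIsometry k hh') hG]
  refine lintegral_congr fun x => ?_
  congr 1
  have hx := extendZero_dotProduct k x
  have hx' : star (extendZero k (tailIsometry k hh' x)) ⬝ᵥ extendZero k (tailIsometry k hh' x)
      = 1 := by
    rw [extendZero_tailIsometry, star_mulVec_dotProduct_mulVec, hx]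
  refine Subtype.ext ?_
  rw [coe_unitaryReflection k hx', extendZero_tailIsometry, reflectionMatrix_mulVec hh]
  change (h : Matrix (Fin n) (Fin n) ℂ) * (unitaryReflection k (extendZero k x) :
    Matrix (Fin n) (Fin n) ℂ) * star (h : Matrix (Fin n) (Fin n) ℂ) = _
  rw [coe_unitaryReflection k hx]

theorem expWeight_conj (k : Fin n) (δ : ℂ) {h : unitaryGroup (Fin n) ℂ}
    (hh : h ∈ headFixing n (k + 1)) (r : unitaryGroup (Fin n) ℂ) :
    expWeight k δ (h * r * h⁻¹) = expWeight k δ r := by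
  have hk : ((h * r * h⁻¹ : unitaryGroup (Fin n) ℂ) : Matrix (Fin n) (Fin n) ℂ) k k
      = (r : Matrix (Fin n) (Fin n) ℂ) k k := by
    rw [Submonoid.coe_mul, Submonoid.coe_mul, mul_apply, Finset.sum_congr rfl fun j _ => by
      rw [apply_right_of_mem_headFixing (inv_mem hh) j (Nat.lt_succ_self _)]]
    simp only [Pi.single_apply, mul_ite, mul_one, mul_zero, Finset.sum_ite_eq', Finset.mem_univ,
      if_true]
    rw [mul_apply, Finset.sum_congr rfl fun j _ => by
      rw [apply_left_of_mem_headFixing hh j (Nat.lt_succ_self _)]]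
    simp [Pi.single_apply]
  rw [expWeight, expWeight, hk]

/-- The laws of the reflections with the index `k` are invariant under conjugation by the unitary
matrices that fix the first `k + 1` basis vectors. -/
theorem nuDelta_preimage_conj (k : Fin n) (δ : ℂ) {h : unitaryGroup (Fin n) ℂ}
    (hh : h ∈ headFixing n (k + 1)) {S : Set (unitaryGroup (Fin n) ℂ)} (hS : MeasurableSet S) :
    nuDelta k δ {r | h * r * h⁻¹ ∈ S} = nuDelta k δ S := by
  have hm : MeasurableSet {r | h * r * h⁻¹ ∈ S} :=
    ((measurable_id.const_mul h).mul_const h⁻¹) hS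
  have hw := (measurable_expWeight k δ).ennreal_ofReal
  rw [nuDelta, sampling_apply _ _ hm, sampling_apply _ _ hS, ← lintegral_indicator hm,
    ← lintegral_indicator hS, ← lintegral_nu_conj k hh (hw.indicator hS)]
  congr 1
  refine lintegral_congr fun r => ?_
  by_cases hr : h * r * h⁻¹ ∈ S
  · rw [Set.indicator_of_mem hr, Set.indicator_of_mem (show r ∈ {r | h * r * h⁻¹ ∈ S} from hr),
      expWeight_conj k δ hh]
  · rw [Set.indicator_of_notMem hr,
      Set.indicator_of_notMem (show r ∉ {r | h * r * h⁻¹ ∈ S} from hr)]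

end ConjugationInvariance

/-! ### Natural exponents give probability measures. -/

section NaturalExponent

open Matrix
open scoped ENNReal

variable {n : ℕ}

instance isProbabilityMeasure_uniformSphere (k : Fin n) :
    IsProbabilityMeasure (uniformSphere k) := by
  constructor
  have h0 : (volume : Measure (TailSpace k)).toSphere Set.univ ≠ 0 := by
    rw [Measure.measure_univ_ne_zero]
    exact Measure.toSphere_ne_zero _
  rw [uniformSphere, Measure.smul_apply, smul_eq_mul,
    ENNReal.inv_mul_cancel h0 (measure_ne_top _ _)]

instance isProbabilityMeasure_nu (k : Fin n) : IsProbabilityMeasure (nu k) :=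
  Measure.isProbabilityMeasure_map (measurable_reflection k).aemeasurable

theorem isProbabilityMeasure_sampling {X : Type*} [MeasurableSpace X] {μ : Measure X} {h : X → ℝ}
    (h0 : ∫⁻ x, ENNReal.ofReal (h x) ∂μ ≠ 0) (h1 : ∫⁻ x, ENNReal.ofReal (h x) ∂μ ≠ ∞) :
    IsProbabilityMeasure (sampling μ h) := by
  constructor
  rw [sampling_apply _ _ MeasurableSet.univ, Measure.restrict_univ, ENNReal.inv_mul_cancel h0 h1]

theorem nuDelta_zero (k : Fin n) : nuDelta k 0 = nu k := by
  have h : ∀ r : unitaryGroup (Fin n) ℂ, expWeight k 0 r = 1 := by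
    intro r; simp [expWeight]
  rw [nuDelta, sampling]
  simp [h]

/-- In the parameters `β`, `η` both the density and the weight are strictly positive everywhere: the
parametrization omits the point `v = e_k`, where `1 - v_k` vanishes. -/
theorem lintegral_expWeight_ne_zero (k : Fin n) (δ : ℂ) :
    ∫⁻ r, ENNReal.ofReal (expWeight k δ r) ∂nu k ≠ 0 := by
  have hvol : (volume : Measure ({j : Fin n // k < j} → ℂ)) ≠ 0 := NeZero.ne _
  have hvolR : (volume : Measure ℝ) ≠ 0 := NeZero.ne _
  have hC0 : ∀ C : ℝ≥0∞, (∀ F : (Fin n → ℂ) → ℝ≥0∞, Measurable F →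
      ∫⁻ x : Metric.sphere (0 : TailSpace k) 1, F (extendZero k x) ∂uniformSphere k
        = C * ∫⁻ β : ℝ, ∫⁻ η : {j : Fin n // k < j} → ℂ,
          ENNReal.ofReal (sphereDensity (Fintype.card {j : Fin n // k < j}) β (sqNorm η)) *
            F (tailPoint k β η)) → C ≠ 0 := by
    rintro C hC rfl
    -- The constant function `1` has integral `1` over the sphere, which excludes `C = 0`.
    have := hC (fun _ => 1) measurable_const
    simp at this
  obtain ⟨C, hC⟩ := exists_lintegral_uniformSphere k
  have hw := (measurable_expWeight k δ).ennreal_ofReal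
  have hwm : Measurable fun v : Fin n → ℂ =>
      ENNReal.ofReal (expWeight k δ (unitaryReflection k v)) :=
    hw.comp (measurable_unitaryReflection k)
  rw [lintegral_nu k hw, hC _ hwm]
  refine mul_ne_zero (hC0 C hC) ?_
  set Φ : ℝ × ({j : Fin n // k < j} → ℂ) → ℝ≥0∞ := fun p =>
    ENNReal.ofReal (sphereDensity (Fintype.card {j : Fin n // k < j}) p.1 (sqNorm p.2)) *
      ENNReal.ofReal (expWeight k δ (unitaryReflection k (tailPoint k p.1 p.2))) with hΦ
  have hΦm : Measurable Φ := by
    have hq : Measurable fun p : ℝ × ({j : Fin n // k < j} → ℂ) => (p.1, sqNorm p.2) :=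
      measurable_fst.prodMk (measurable_sqNorm.comp measurable_snd)
    exact ((measurable_sphereDensity _).comp hq).ennreal_ofReal.mul
      (hwm.comp (measurable_tailPoint k))
  have hpos : ∀ p, Φ p ≠ 0 := by
    rintro ⟨β, η⟩
    refine mul_ne_zero ?_ ?_
    · exact (ENNReal.ofReal_pos.2 (sphereDensity_pos _ β (sqNorm_nonneg η))).ne'
    · have : expWeight k δ (unitaryReflection k (tailPoint k β η))
          = entryWeight δ (sphereHead β (sqNorm η)) := by
        rw [expWeight, coe_unitaryReflection k (star_tailPoint_dotProduct k β η),
          reflectionMatrix_apply_self, entryWeight, tailPoint, tailVec_self]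
      dsimp only
      rw [this]
      exact (ENNReal.ofReal_pos.2 (entryWeight_sphereHead_pos δ β (sqNorm_nonneg η))).ne'
  change ∫⁻ β : ℝ, ∫⁻ η : {j : Fin n // k < j} → ℂ, Φ (β, η) ≠ 0
  rw [← lintegral_prod _ hΦm.aemeasurable, Ne, lintegral_eq_zero_iff hΦm]
  intro h
  have hz : (volume : Measure ℝ).prod (volume : Measure ({j : Fin n // k < j} → ℂ)) Set.univ
      = 0 := by
    rw [← nonpos_iff_eq_zero]
    refine (measure_mono fun p _ => ?_).trans_eq (ae_iff.1 h)
    exact hpos p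
  rw [← Set.univ_prod_univ, Measure.prod_prod, mul_eq_zero, Measure.measure_univ_eq_zero,
    Measure.measure_univ_eq_zero] at hz
  exact hz.elim hvolR hvol

theorem isProbabilityMeasure_nuDelta_natCast (k : Fin n) (p : ℕ) :
    IsProbabilityMeasure (nuDelta k (p : ℂ)) := by
  refine isProbabilityMeasure_sampling (lintegral_expWeight_ne_zero k p) ?_
  -- Entries of a unitary matrix have modulus at most `1`, so each of the two `p`-th powers is at
  -- most `2 ^ p`.
  have hle : ∀ r : unitaryGroup (Fin n) ℂ, expWeight k (p : ℂ) r ≤ 2 ^ p * 2 ^ p := by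
    intro r
    have h1 : ‖(r : Matrix (Fin n) (Fin n) ℂ) k k‖ ≤ 1 := entry_norm_bound_of_unitary r.2 k k
    have h2 : ‖1 - (r : Matrix (Fin n) (Fin n) ℂ) k k‖ ≤ 2 :=
      (norm_sub_le _ _).trans (by rw [norm_one]; linarith)
    have h3 : ‖1 - star ((r : Matrix (Fin n) (Fin n) ℂ) k k)‖ ≤ 2 :=
      (norm_sub_le _ _).trans (by rw [norm_one, norm_star]; linarith)
    refine (Complex.re_le_norm _).trans ?_
    have hs : star (p : ℂ) = (p : ℂ) := by simp
    rw [hs, Complex.cpow_natCast, Complex.cpow_natCast, norm_mul, norm_pow, norm_pow]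
    gcongr
  have : ∫⁻ r, ENNReal.ofReal (expWeight k (p : ℂ) r) ∂nu k ≤ ENNReal.ofReal (2 ^ p * 2 ^ p) := by
    refine (lintegral_mono fun r => ENNReal.ofReal_le_ofReal (hle r)).trans ?_
    rw [lintegral_const, measure_univ, mul_one]
  exact ne_top_of_le_ne_top ENNReal.ofReal_ne_top this

end NaturalExponent

/-! ### Laws of ordered products and the induction on their length. -/

section OrderedProducts

open Matrix
open scoped ENNReal

variable {n m : ℕ}

theorem measurable_list_ofFn_prod :
    Measurable fun r : Fin m → unitaryGroup (Fin n) ℂ => (List.ofFn r).prod := by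
  induction m with
  | zero => simp only [List.ofFn_zero, List.prod_nil]; exact measurable_const
  | succ m ih =>
    simp only [List.ofFn_succ, List.prod_cons]
    exact (measurable_pi_apply 0).mul
      (ih.comp (measurable_pi_iff.2 fun i => measurable_pi_apply i.succ))

/-- The law of the ordered product of independent random unitary matrices with given laws. -/
noncomputable def orderedLaw (μ : Fin m → Measure (unitaryGroup (Fin n) ℂ)) :
    Measure (unitaryGroup (Fin n) ℂ) :=
  (Measure.pi μ).map fun r => (List.ofFn r).prod

instance isProbabilityMeasure_orderedLaw (μ : Fin m → Measure (unitaryGroup (Fin n) ℂ))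
    [∀ i, IsProbabilityMeasure (μ i)] : IsProbabilityMeasure (orderedLaw μ) :=
  Measure.isProbabilityMeasure_map measurable_list_ofFn_prod.aemeasurable

theorem orderedLaw_succ (μ : Fin (m + 1) → Measure (unitaryGroup (Fin n) ℂ))
    [∀ i, IsProbabilityMeasure (μ i)] :
    orderedLaw μ = (μ 0).mconv (orderedLaw fun i => μ i.succ) := by
  have hF := measurable_list_ofFn_prod (n := n) (m := m)
  have hmul : Measurable fun p : unitaryGroup (Fin n) ℂ × unitaryGroup (Fin n) ℂ => p.1 * p.2 :=
    measurable_fst.mul measurable_snd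
  have he := measurePreserving_piFinSuccAbove μ 0
  have h2 : (μ 0).prod (orderedLaw fun i => μ i.succ)
      = ((μ 0).prod (Measure.pi fun i => μ i.succ)).map
        (Prod.map id fun r : Fin m → unitaryGroup (Fin n) ℂ => (List.ofFn r).prod) := by
    rw [← Measure.map_prod_map _ _ measurable_id hF, Measure.map_id, orderedLaw]
  have h1 : (μ 0).prod (Measure.pi fun i : Fin m => μ i.succ)
      = (Measure.pi μ).map (MeasurableEquiv.piFinSuccAbove
        (fun _ : Fin (m + 1) => unitaryGroup (Fin n) ℂ) 0) := he.map_eq.symm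
  rw [Measure.mconv, h2, h1,
    Measure.map_map (measurable_id.prodMap hF) (MeasurableEquiv.measurable _),
    Measure.map_map hmul
      ((measurable_id.prodMap hF).comp (MeasurableEquiv.measurable _)), orderedLaw]
  congr 1
  funext r
  rw [List.ofFn_succ, List.prod_cons]
  rfl

theorem mconv_apply_eq_lintegral (μ ν : Measure (unitaryGroup (Fin n) ℂ)) [SFinite μ] [SFinite ν]
    {s : Set (unitaryGroup (Fin n) ℂ)} (hs : MeasurableSet s) :
    μ.mconv ν s = ∫⁻ a, μ {r | r * a ∈ s} ∂ν := by
  have hmul : Measurable fun p : unitaryGroup (Fin n) ℂ × unitaryGroup (Fin n) ℂ => p.1 * p.2 :=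
    measurable_fst.mul measurable_snd
  rw [Measure.mconv, Measure.map_apply hmul hs, Measure.prod_apply_symm (hmul hs)]
  rfl

theorem ae_mem_orderedLaw (μ : Fin m → Measure (unitaryGroup (Fin n) ℂ))
    [∀ i, IsProbabilityMeasure (μ i)] {k : ℕ} (h : ∀ i, ∀ᵐ r ∂μ i, r ∈ headFixing n k) :
    ∀ᵐ a ∂orderedLaw μ, a ∈ headFixing n k := by
  refine (ae_map_iff measurable_list_ofFn_prod.aemeasurable (measurableSet_headFixing k)).2 ?_
  have hi : ∀ᵐ r ∂Measure.pi μ, ∀ i, r i ∈ headFixing n k :=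
    Filter.eventually_all.2 fun i => Measure.tendsto_eval_ae_ae.eventually (h i)
  refine hi.mono fun r hr => Subgroup.list_prod_mem _ fun a ha => ?_
  obtain ⟨i, rfl⟩ := (List.mem_ofFn' _ _).1 ha
  exact hr i

/-- Preimages under a class function are conjugation invariant sets, so the two measures have the
same image under `f`. -/
theorem lintegral_eq_of_conjInvariant {G : Subgroup (unitaryGroup (Fin n) ℂ)}
    {μ ν : Measure (unitaryGroup (Fin n) ℂ)}
    (h : ∀ s, MeasurableSet s → ConjInvariant G s → μ s = ν s)
    {f : unitaryGroup (Fin n) ℂ → ℝ≥0∞} (hf : Measurable f)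
    (hG : ∀ g ∈ G, ∀ u, f (g * u * g⁻¹) = f u) : ∫⁻ u, f u ∂μ = ∫⁻ u, f u ∂ν := by
  have hmap : μ.map f = ν.map f := by
    ext t ht
    rw [Measure.map_apply hf ht, Measure.map_apply hf ht]
    refine h _ (hf ht) fun g hg u => ?_
    rw [Set.mem_preimage, Set.mem_preimage, hG g hg]
  have h1 := lintegral_map (μ := μ) measurable_id hf
  have h2 := lintegral_map (μ := ν) measurable_id hf
  simp only [id] at h1 h2
  rw [← h1, ← h2, hmap]

/-- The general slipping lemma: raising all the indices and all the exponents by one does not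
change the law of the product on conjugation invariant sets. -/
theorem orderedLaw_slip (m : ℕ) : ∀ (k : ℕ) (idx idx' : Fin m → Fin n),
    (∀ i, (idx i : ℕ) = k + i) → (∀ i, (idx' i : ℕ) = k + i + 1) → ∀ δ : Fin m → ℂ,
    (∀ i, IsProbabilityMeasure (nuDelta (idx i) (δ i))) →
    (∀ i, IsProbabilityMeasure (nuDelta (idx' i) (δ i + 1))) →
    ∀ s, MeasurableSet s → ConjInvariant (headFixing n k) s →
      orderedLaw (fun i => nuDelta (idx i) (δ i)) s
        = orderedLaw (fun i => nuDelta (idx' i) (δ i + 1)) s := by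
  induction m with
  | zero =>
    intro k idx idx' _ _ δ _ _ s _ _
    have : (fun i => nuDelta (idx i) (δ i)) = fun i => nuDelta (idx' i) (δ i + 1) :=
      funext fun i => i.elim0
    rw [this]
  | succ m ih =>
    intro k idx idx' hidx hidx' δ hp hp' s hs hinv
    have h0 : (idx 0 : ℕ) = k := by simpa using hidx 0
    have h0' : (idx' 0 : ℕ) = idx 0 + 1 := by rw [h0]; simpa using hidx' 0
    have hp0 := hp 0
    have hp0' := hp' 0
    rw [orderedLaw_succ, orderedLaw_succ, mconv_apply_eq_lintegral _ _ hs,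
      mconv_apply_eq_lintegral _ _ hs]
    have hmeas : Measurable fun a => nuDelta (idx 0) (δ 0) {r | r * a ∈ s} :=
      measurable_measure_prodMk_right
        (s := {p : unitaryGroup (Fin n) ℂ × unitaryGroup (Fin n) ℂ | p.1 * p.2 ∈ s})
        ((measurable_fst.mul measurable_snd) hs)
    -- The tail is slipped first, with the first factor averaged out. The integrand is invariant
    -- under `headFixing n (k + 1)`: the matrix `r g u g⁻¹` is conjugate by `g` to `(g⁻¹ r g) u`,
    -- and `g⁻¹ r g` has the law of `r`.
    have htail : ∫⁻ a, nuDelta (idx 0) (δ 0) {r | r * a ∈ s}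
          ∂(orderedLaw fun i : Fin m => nuDelta (idx i.succ) (δ i.succ))
        = ∫⁻ a, nuDelta (idx 0) (δ 0) {r | r * a ∈ s}
          ∂(orderedLaw fun i : Fin m => nuDelta (idx' i.succ) (δ i.succ + 1)) := by
      refine lintegral_eq_of_conjInvariant (G := headFixing n (k + 1))
        (ih (k + 1) (fun i => idx i.succ) (fun i => idx' i.succ)
          (fun i => by rw [hidx, Fin.val_succ]; ring) (fun i => by rw [hidx', Fin.val_succ]; ring)
          (fun i => δ i.succ) (fun i => hp i.succ) (fun i => hp' i.succ)) hmeas fun g hg u => ?_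
      have hg' : g⁻¹ ∈ headFixing n (idx 0 + 1) := by rw [h0]; exact inv_mem hg
      have hm : MeasurableSet {r | r * u ∈ s} := measurable_mul_const u hs
      rw [← nuDelta_preimage_conj (idx 0) (δ 0) hg' hm]
      congr 1
      ext r
      rw [Set.mem_ofPred_eq, Set.mem_ofPred_eq, Set.mem_ofPred_eq,
        ← hinv g (headFixing_anti n (Nat.le_succ k) hg) (g⁻¹ * r * g⁻¹⁻¹ * u)]
      have : g * (g⁻¹ * r * g⁻¹⁻¹ * u) * g⁻¹ = r * (g * u * g⁻¹) := by group
      rw [this]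
    rw [htail]
    -- After the slip the indices in the tail are at least `k + 2`, so the tail fixes `e_0, …,
    -- e_{k+1}`, as the slip of the first factor requires. The unslipped tail need not fix
    -- `e_{k+1}`.
    have hae : ∀ᵐ a ∂(orderedLaw fun i : Fin m => nuDelta (idx' i.succ) (δ i.succ + 1)),
        a ∈ headFixing n (idx 0 + 2) := by
      refine ae_mem_orderedLaw _ fun i =>
        (ae_mem_headFixing_nuDelta (idx' i.succ) (δ i.succ + 1)).mono fun r hr => ?_
      refine headFixing_anti n ?_ hr
      rw [hidx', h0, Fin.val_succ]
      omega
    refine lintegral_congr_ae (hae.mono fun a ha => ?_)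
    exact nuDelta_preimage_mul_right_eq h0' (δ 0) ha hs (by rw [h0]; exact hinv)

theorem map_orderedProd {Ω : Type*} [MeasurableSpace Ω] {P : Measure Ω} [IsProbabilityMeasure P]
    {r : Fin m → Ω → unitaryGroup (Fin n) ℂ} {μ : Fin m → Measure (unitaryGroup (Fin n) ℂ)}
    (hr : ∀ i, HasLaw (r i) (μ i) P) (hind : iIndepFun r P) :
    AEMeasurable (orderedProd r) P ∧ P.map (orderedProd r) = orderedLaw μ := by
  have hm : AEMeasurable (fun ω i => r i ω) P := aemeasurable_pi_iff.2 fun i => (hr i).aemeasurable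
  have hpi : P.map (fun ω i => r i ω) = Measure.pi μ := by
    rw [(iIndepFun_iff_map_fun_eq_pi_map fun i => (hr i).aemeasurable).1 hind]
    congr 1
    funext i
    exact (hr i).map_eq
  refine ⟨measurable_list_ofFn_prod.comp_aemeasurable hm, ?_⟩
  rw [orderedLaw, ← hpi, AEMeasurable.map_map_of_aemeasurable
    measurable_list_ofFn_prod.aemeasurable hm]
  rfl

/-- Events described by the spectrum are invariant under conjugation by the whole unitary group,
which is `headFixing n 0`. Independence within each family determines the law of its product. -/
theorem spectraEquallyDistributed_of_orderedLaw {Ω Ω' : Type*} [MeasurableSpace Ω]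
    [MeasurableSpace Ω'] {P : Measure Ω} [IsProbabilityMeasure P] {P' : Measure Ω'}
    [IsProbabilityMeasure P'] {m' : ℕ} {r : Fin m → Ω → unitaryGroup (Fin n) ℂ}
    {s : Fin m' → Ω' → unitaryGroup (Fin n) ℂ} {μ : Fin m → Measure (unitaryGroup (Fin n) ℂ)}
    {ν : Fin m' → Measure (unitaryGroup (Fin n) ℂ)}
    (hr : ∀ i, HasLaw (r i) (μ i) P) (hrind : iIndepFun r P)
    (hs : ∀ i, HasLaw (s i) (ν i) P') (hsind : iIndepFun s P')
    (h : ∀ t, MeasurableSet t → ConjInvariant (headFixing n 0) t →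
      orderedLaw μ t = orderedLaw ν t) :
    SpectraEquallyDistributed (orderedProd r) (orderedProd s) P P' := by
  obtain ⟨hrm, hrl⟩ := map_orderedProd hr hrind
  obtain ⟨hsm, hsl⟩ := map_orderedProd hs hsind
  refine ⟨measurable_spectralCount.comp_aemeasurable hrm,
    measurable_spectralCount.comp_aemeasurable hsm, ?_⟩
  have h1 := AEMeasurable.map_map_of_aemeasurable measurable_spectralCount.aemeasurable hrm
  have h2 := AEMeasurable.map_map_of_aemeasurable measurable_spectralCount.aemeasurable hsm
  have h1' : P.map (fun ω => spectralCount (orderedProd r ω))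
      = (orderedLaw μ).map spectralCount := by
    rw [← hrl, h1]; rfl
  have h2' : P'.map (fun ω => spectralCount (orderedProd s ω))
      = (orderedLaw ν).map spectralCount := by
    rw [← hsl, h2]; rfl
  rw [h1', h2']
  ext t ht
  rw [Measure.map_apply measurable_spectralCount ht, Measure.map_apply measurable_spectralCount ht]
  refine h _ (measurable_spectralCount ht) fun g _ u => ?_
  rw [Set.mem_preimage, Set.mem_preimage, spectralCount_conj]

theorem ProbabilityTheory.HasLaw.isProbabilityMeasure_law {Ω X : Type*} [MeasurableSpace Ω]
    [MeasurableSpace X] {P : Measure Ω} [IsProbabilityMeasure P] {f : Ω → X} {μ : Measure X} (h : HasLaw f μ P) :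
    IsProbabilityMeasure μ := by
  rw [← h.map_eq]
  exact Measure.isProbabilityMeasure_map h.aemeasurable

theorem orderedLaw_slip_iterate (p : ℕ) : ∀ (idx idx' : Fin m → Fin n),
    (∀ i, (idx i : ℕ) = i) → (∀ i, (idx' i : ℕ) = i + p) →
    ∀ s, MeasurableSet s → ConjInvariant (headFixing n 0) s →
      orderedLaw (fun i => nu (idx i)) s = orderedLaw (fun i => nuDelta (idx' i) (p : ℂ)) s := by
  induction p with
  | zero =>
    intro idx idx' hidx hidx' s _ _
    have : idx = idx' := funext fun i => Fin.ext (by rw [hidx, hidx', add_zero])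
    simp only [this, Nat.cast_zero, nuDelta_zero]
  | succ p ih =>
    intro idx idx' hidx hidx' s hs hinv
    have hlt : ∀ i : Fin m, (i : ℕ) + p < n := fun i => by
      have := (idx' i).2
      rw [hidx' i] at this
      omega
    rw [ih idx (fun i => ⟨i + p, hlt i⟩) hidx (fun i => rfl) s hs hinv]
    -- The next slip starts at index `p` with all exponents equal to `p`. It needs invariance only
    -- under `headFixing n p`, while `s` is invariant under every conjugation.
    rw [orderedLaw_slip m p (fun i => ⟨i + p, hlt i⟩) idx' (fun i => add_comm _ _)
      (fun i => by rw [hidx']; ring) (fun _ => (p : ℂ))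
      (fun i => isProbabilityMeasure_nuDelta_natCast _ p)
      (fun i => by exact_mod_cast isProbabilityMeasure_nuDelta_natCast (idx' i) (p + 1)) s hs
      fun g _ u => hinv g (headFixing_zero n g) u]
    push_cast
    rfl

end OrderedProducts

/-- The slipping lemma, its version for the laws `ν_δ^{(k)}`, and the iterated version.
With the coordinates counted from `0`, the member `i` of the first family moves the coordinates
`≥ i`, and the member `i` of the second family moves the coordinates `≥ i + 1` (resp. `≥ i + p`).
Each family is independent; how the two families depend on each other does not matter, and they may
live on different probability spaces. -/
theorem lemma3p3 {Ω Ω' : Type*} [MeasurableSpace Ω] [MeasurableSpace Ω']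
    (P : Measure Ω) [IsProbabilityMeasure P] (P' : Measure Ω') [IsProbabilityMeasure P'] (n : ℕ) :
    (∀ (r : Fin (n - 1) → Ω → Matrix.unitaryGroup (Fin n) ℂ)
        (s : Fin (n - 1) → Ω' → Matrix.unitaryGroup (Fin n) ℂ),
        (∀ i : Fin (n - 1), HasLaw (r i) (nu (⟨i, by omega⟩ : Fin n)) P) →
        iIndepFun r P →
        (∀ i : Fin (n - 1), HasLaw (s i) (nuDelta (⟨i + 1, by omega⟩ : Fin n) 1) P') →
        iIndepFun s P' →
        SpectraEquallyDistributed (orderedProd r) (orderedProd s) P P') ∧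
    (∀ (m : ℕ) (hm : m < n) (δ : Fin m → ℂ), (∀ i, -(1 / 2 : ℝ) < (δ i).re) →
        ∀ (r : Fin m → Ω → Matrix.unitaryGroup (Fin n) ℂ)
          (s : Fin m → Ω' → Matrix.unitaryGroup (Fin n) ℂ),
        (∀ i : Fin m, HasLaw (r i) (nuDelta (⟨i, by omega⟩ : Fin n) (δ i)) P) →
        iIndepFun r P →
        (∀ i : Fin m, HasLaw (s i) (nuDelta (⟨i + 1, by omega⟩ : Fin n) (δ i + 1)) P') →
        iIndepFun s P' →
        SpectraEquallyDistributed (orderedProd r) (orderedProd s) P P') ∧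
    (∀ (p : ℕ) (_ : p ≤ n)
        (r : Fin (n - p) → Ω → Matrix.unitaryGroup (Fin n) ℂ)
        (s : Fin (n - p) → Ω' → Matrix.unitaryGroup (Fin n) ℂ),
        (∀ i : Fin (n - p), HasLaw (r i) (nu (⟨i, by omega⟩ : Fin n)) P) →
        iIndepFun r P →
        (∀ i : Fin (n - p), HasLaw (s i) (nuDelta (⟨i + p, by omega⟩ : Fin n) (p : ℂ)) P') →
        iIndepFun s P' →
        SpectraEquallyDistributed (orderedProd r) (orderedProd s) P P') := by
  have iter : ∀ (p : ℕ) (m : ℕ) (hm : m + p ≤ n)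
      (r : Fin m → Ω → Matrix.unitaryGroup (Fin n) ℂ)
      (s : Fin m → Ω' → Matrix.unitaryGroup (Fin n) ℂ),
      (∀ i : Fin m, HasLaw (r i) (nu (⟨i, by omega⟩ : Fin n)) P) → iIndepFun r P →
      (∀ i : Fin m, HasLaw (s i) (nuDelta (⟨i + p, by omega⟩ : Fin n) (p : ℂ)) P') →
      iIndepFun s P' → SpectraEquallyDistributed (orderedProd r) (orderedProd s) P P' := by
    intro p m hm r s hr hri hs hsi
    exact spectraEquallyDistributed_of_orderedLaw hr hri hs hsi
      (orderedLaw_slip_iterate p _ _ (fun _ => rfl) fun _ => rfl)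
  refine ⟨fun r s hr hri hs hsi => ?_, fun m hm δ _ r s hr hri hs hsi => ?_,
    fun p hp r s hr hri hs hsi => ?_⟩
  · rcases n with _ | n
    -- For `n = 0` truncated subtraction gives `n - 1 = 0`, so both products are empty; the iterated
    -- form with `p = 1` would need `n ≥ 1`.
    · exact spectraEquallyDistributed_of_orderedLaw hr hri hs hsi fun t _ _ => by
        congr 2
        exact funext fun i => i.elim0
    · refine iter 1 n le_rfl r s hr hri (fun i => ?_) hsi
      rw [Nat.cast_one]
      exact hs i
  · refine spectraEquallyDistributed_of_orderedLaw hr hri hs hsi ?_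
    exact orderedLaw_slip m 0 (fun i : Fin m => (⟨i, by omega⟩ : Fin n))
      (fun i : Fin m => (⟨i + 1, by omega⟩ : Fin n)) (fun i => (zero_add _).symm)
      (fun i => by rw [zero_add]) δ
      (fun i => (hr i).isProbabilityMeasure_law) (fun i => (hs i).isProbabilityMeasure_law)
  · exact iter p (n - p) (Nat.sub_add_cancel hp).le r s hr hri hs hsi
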